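/- **Setting.** Let $\Gamma$ be a plumbing tree: a finite non-empty tree with vertex set $V$ and integer weights $a_v$. Its plumbing matrix $M$ has $M_{vv}=a_v$, $M_{vw}=1$ if $v\neq w$ are adjacent, and all other entries $0$. Let $\pi$ be the number of positive eigenvalues of $M$ and $\sigma$ its signature. $\Gamma$ is *weakly negative* if $M$ is invertible and $M^{-1}$ is negative definite on the span of the vertices of degree $\ge 3$. Let $\nu_v\in\mathbb Z_{\ge0}$ $(v\in V)$ be highest weights of $\mathfrak{sl}_2$ (the defect nodes are those with $\nu_v\ne0$), with characters $\chi_\nu(z)=\frac{z^{1+\nu}-z^{-1-\nu}}{z-z^{-1}}=\sum_{k=0}^{\nu}z^{\nu-2k}$. Put $\delta_v=\deg v \bmod 2$ and $\mathrm{Spin}^c(\Gamma)=(2\mathbb Z^V+\delta)/2M\mathbb Z^V$. For $b\in\mathrm{Spin}^c(\Gamma)$ and $\tau\in\mathbb H$, $q=e^{2\pi i\tau}$, the defect $\hat Z$-invariant is $$\hat Z_b(\Gamma;W_\nu;\tau)=(-1)^{\pi}q^{\frac{3\sigma-\sum_v a_v}{4}}\;\mathrm{vp}\!\oint\prod_{v\in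 V}\frac{dz_v}{2\pi i z_v}\Bigl(z_v-\frac1{z_v}\Bigr)^{2-\deg v}\chi_{\nu_v}(z_v)\;\Theta_{b+\nu}(\tau;z),\qquad \Theta_{\beta}(\tau;z)=\sum_{\ell\in 2M\mathbb Z^V\pm\beta}q^{-\ell^TM^{-1}\ell/4}\prod_v z_v^{\ell_v}.$$ Here the sum runs over the set $(2M\mathbb Z^V+\beta)\cup(2M\mathbb Z^V-\beta)$, $\mathrm{vp}\oint$ is, in each variable, the limit as $\varepsilon\to0^+$ of the half-sum of the integrals over $|z_v|=1+\varepsilon$ and $|z_v|=1-\varepsilon$, and the theta series is integrated term by term. **Moves.** Besides isomorphisms of decorated plumbing trees (acting on labels by relabelling), the 3d Kirby (Neumann) moves are the following and their inverses. New vertices have $\nu=0$ and old vertices keep their $\nu_v$. Each move is listed with its action on the shifted label $\beta=b+\nu$. * *Edge blow-up* ($\varepsilon=\pm1$): an edge $uv$ is replaced by a path $u - n - v$, where $n$ is a new vertex of weight $\varepsilon$, and $a_u,a_v$ increase by $\varepsilon$. The label is $0$ at $n$, is unchanged on the side of $u$, and is multiplied by $-\varepsilon$ on the side of $v$. * *Leaf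 blow-up* ($\varepsilon=\pm1$): a new leaf $n$ of weight $\varepsilon$ is attached to $v$ and $a_v$ increases by $\varepsilon$. The label is $\varepsilon$ at $n$, is $\beta_v+1$ at $v$, and is otherwise unchanged. * *$0$-chain extrusion* (inverse of $0$-chain absorption $a_1 - 0 - a_2\to a_1+a_2$): a vertex $w$ is replaced by a path $w - n_0 - n_1$ with weights $a_w-c,\,0,\,c$ $(c\in\mathbb Z)$, and a set $N$ of neighbours of $w$ is re-attached to $n_1$ instead of $w$. With $k=|N|+1$, the label is $\beta_w+k$ at $w$, $0$ at $n_0$, $k$ at $n_1$; it changes sign on the branches at $w$ that are moved to $n_1$, and is otherwise unchanged. **Proposition.** 1. For every weakly negative plumbing tree $\Gamma$, every $\nu$, $b$ and $\tau$, all the principal value integrals exist and the resulting series over $\ell$ converges absolutely. 2. If $\Gamma'$ is obtained from $\Gamma$ by one of the above moves and both are weakly negative, then the action on shifted labels induces a bijection $\varphi:\mathrm{Spin}^c(\Gamma)\to\mathrm{Spin}^c(\Gamma')$, $\beta=b+\nu\mapsto\beta'=b'+\nu'$, and $\hat Z_{\varphi(b)}(\Gamma';W_{\nu'};\tau)=\hat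 Z_b(\Gamma;W_\nu;\tau)$ for all $b$ and $\tau$. 3. Consequently $\hat Z$ takes the same value on any two labelled weakly negative plumbing trees related by a finite sequence of such moves and their inverses through weakly negative trees, the labels $b$ being identified as above. It is in this sense a topological invariant of the plumbed three-manifold with its defects. -/

import Mathlib

open scoped UpperHalfPlane Topology

universe u

noncomputable section

/-- A plumbing graph with a Wilson line of highest weight `nu v • ω` (with `ω` the fundamental
weight of `sl₂`) attached to each node `v`; the nodes carrying a defect are those with
`nu v ≠ 0` (`nu v = 0` is the trivial representation). -/
structure DefectPlumbing : Type (u + 1) where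
  V : Type u
  [fintypeV : Fintype V]
  graph : SimpleGraph V
  weight : V → ℤ
  nu : V → ℕ

namespace DefectPlumbing

attribute [instance] DefectPlumbing.fintypeV

/-! ### The plumbing matrix -/

section Basic

variable (P : DefectPlumbing.{u})

open scoped Classical in
/-- Number of neighbours of a node. -/
def deg (v : P.V) : ℕ := P.graph.degree v

open scoped Classical in
/-- The plumbing matrix `M`. -/
def intMatrix : Matrix P.V P.V ℤ :=
  Matrix.of fun v w => if v = w then P.weight v else if P.graph.Adj v w then 1 else 0

/-- The plumbing matrix with real entries. -/
def matrix : Matrix P.V P.V ℝ := P.intMatrix.map (fun n : ℤ => (n : ℝ))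

theorem intMatrix_comm (v w : P.V) : P.intMatrix v w = P.intMatrix w v := by
  simp only [intMatrix, Matrix.of_apply]
  by_cases h : v = w
  · subst h; rfl
  · rw [if_neg h, if_neg (Ne.symm h)]
    by_cases h' : P.graph.Adj v w
    · rw [if_pos h', if_pos h'.symm]
    · rw [if_neg h', if_neg fun h'' => h' h''.symm]

theorem matrix_isHermitian : P.matrix.IsHermitian := by
  ext v w
  simp [matrix, P.intMatrix_comm v w]

open scoped Classical in
/-- The number `π` of positive eigenvalues of `M` (with multiplicity). -/
def numPos : ℕ := (Finset.univ.filter fun i => 0 < P.matrix_isHermitian.eigenvalues i).card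

open scoped Classical in
/-- The number of negative eigenvalues of `M` (with multiplicity). -/
def numNeg : ℕ := (Finset.univ.filter fun i => P.matrix_isHermitian.eigenvalues i < 0).card

/-- The signature `σ` of `M`. -/
def sig : ℤ := (P.numPos : ℤ) - (P.numNeg : ℤ)

open scoped Classical in
/-- The quadratic form `ℓᵀ M⁻¹ ℓ`. -/
def invForm (x : P.V → ℝ) : ℝ := x ⬝ᵥ (P.matrix⁻¹).mulVec x

open scoped Classical in
/-- A plumbing tree is weakly negative if `M` is invertible and `M⁻¹` is negative definite on the
subspace spanned by the nodes of degree at least three. -/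
structure IsWeaklyNegativeTree : Prop where
  isTree : P.graph.IsTree
  det_ne_zero : P.matrix.det ≠ 0
  neg_def : ∀ x : P.V → ℝ, (∀ v, P.deg v < 3 → x v = 0) → x ≠ 0 → P.invForm x < 0

/-! ### `Spin^c` structures -/

/-- Representatives of `Spin^c` structures: the elements of `2ℤ^V + δ`, `δ_v = deg v mod 2`. -/
def Label : Type u := {b : P.V → ℤ // ∀ v, Even (b v - (P.deg v : ℤ))}

/-- Congruence of labels modulo `2Mℤ^V`. -/
def labelSetoid : Setoid P.Label where
  r b c := ∃ n : P.V → ℤ, b.1 - c.1 = 2 • P.intMatrix.mulVec n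
  iseqv :=
    { refl := fun b => ⟨0, by simp⟩
      symm := by
        rintro b c ⟨n, hn⟩
        refine ⟨-n, ?_⟩
        rw [Matrix.mulVec_neg, smul_neg, ← hn, neg_sub]
      trans := by
        rintro b c d ⟨n, hn⟩ ⟨m, hm⟩
        refine ⟨n + m, ?_⟩
        rw [Matrix.mulVec_add, smul_add, ← hn, ← hm, sub_add_sub_cancel] }

/-- `(2ℤ^V + δ) / 2Mℤ^V`. -/
def SpinC : Type u := Quotient P.labelSetoid

/-- The class of a label. -/
def Label.toSpinC {P : DefectPlumbing.{u}} (b : P.Label) : P.SpinC := Quotient.mk P.labelSetoid b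

/-- The shifted label `b + ν`. -/
def Label.shifted {P : DefectPlumbing.{u}} (b : P.Label) : P.V → ℤ := fun v => b.1 v + (P.nu v : ℤ)

end Basic

end DefectPlumbing

/-! ### Principal value torus integrals -/

/-- `∮_{|z_v| = r_v} ∏_v dz_v / (2πi z_v) f(z)`, with `z_v = r_v e^{iθ_v}`. -/
def torusMean {V : Type u} [Fintype V] (r : V → ℝ) (f : (V → ℂ) → ℂ) : ℂ :=
  ((2 * Real.pi : ℝ) : ℂ)⁻¹ ^ Fintype.card V *
    ∫ θ in Set.Icc (0 : V → ℝ) (fun _ => 2 * Real.pi),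
      f (fun v => (r v : ℂ) * Complex.exp ((θ v : ℂ) * Complex.I))

open scoped Classical in
/-- For each variable, the half-sum of the integrals over `|z_v| = 1 + ε` and `|z_v| = 1 - ε`. -/
def vpApprox {V : Type u} [Fintype V] (f : (V → ℂ) → ℂ) (ε : ℝ) : ℂ :=
  (2 : ℂ)⁻¹ ^ Fintype.card V *
    ∑ s : V → ℤˣ, torusMean (fun v => 1 + (((s v : ℤˣ) : ℤ) : ℝ) * ε) f

/-- The principal value integral `vp ∮ ∏_v dz_v / (2πi z_v) f(z)` over `|z_v| = 1`. -/
def vpIntegral {V : Type u} [Fintype V] (f : (V → ℂ) → ℂ) : ℂ :=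
  Filter.limUnder (𝓝[>] (0 : ℝ)) (vpApprox f)

/-- `q^r` with `q = e^{2πiτ}`. -/
def qPow (τ : ℍ) (r : ℝ) : ℂ := Complex.exp (2 * Real.pi * Complex.I * (τ : ℂ) * (r : ℂ))

/-- The `sl₂` character `χ_ν(z) = (z^{1+ν} - z^{-1-ν}) / (z - z^{-1}) = ∑_{k=0}^ν z^{ν-2k}`. -/
def sl2Char (ν : ℕ) (z : ℂ) : ℂ := ∑ k ∈ Finset.range (ν + 1), z ^ ((ν : ℤ) - 2 * (k : ℤ))

namespace DefectPlumbing

section Zhat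

variable (P : DefectPlumbing.{u})

/-- The index set `2Mℤ^V ± β` of the theta function. -/
def thetaIndex (β : P.V → ℤ) : Set (P.V → ℤ) :=
  {ℓ | (∃ n : P.V → ℤ, ℓ = 2 • P.intMatrix.mulVec n + β) ∨
       (∃ n : P.V → ℤ, ℓ = 2 • P.intMatrix.mulVec n - β)}

/-- The term `q^{-ℓᵀ M⁻¹ ℓ / 4} z^ℓ` of the theta function. -/
def thetaTerm (τ : ℍ) (ℓ : P.V → ℤ) (z : P.V → ℂ) : ℂ :=
  qPow τ (-(P.invForm fun v => (ℓ v : ℝ)) / 4) * ∏ v, z v ^ ℓ v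

/-- The factor of the integrand multiplying the theta function. -/
def kernel (z : P.V → ℂ) : ℂ :=
  (∏ v, (z v - (z v)⁻¹) ^ ((2 : ℤ) - (P.deg v : ℤ))) * ∏ v, sl2Char (P.nu v) (z v)

/-- The contribution of the theta term indexed by `ℓ` to the integral. -/
def zhatTerm (τ : ℍ) (ℓ : P.V → ℤ) : ℂ :=
  vpIntegral fun z => P.kernel z * P.thetaTerm τ ℓ z

/-- The prefactor `(-1)^π q^{(3σ - ∑_v a_v)/4}`. -/
def prefactor (τ : ℍ) : ℂ :=
  (-1) ^ P.numPos * qPow τ ((3 * (P.sig : ℝ) - ∑ v, (P.weight v : ℝ)) / 4)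

/-- The defect `Ẑ`-invariant of a label `b`: prefactor times the principal value integral of
`kernel · Θ_{b+ν}`, the theta series being integrated term by term (`Θ` need not converge when `M`
is not negative definite). -/
def zhatLabel (b : P.Label) (τ : ℍ) : ℂ :=
  P.prefactor τ * ∑' ℓ : P.thetaIndex b.shifted, P.zhatTerm τ ℓ

theorem thetaIndex_congr {b c : P.Label} (h : ∃ n, b.1 - c.1 = 2 • P.intMatrix.mulVec n) :
    P.thetaIndex b.shifted = P.thetaIndex c.shifted := by
  obtain ⟨n, hn⟩ := h
  have hs : b.shifted = 2 • P.intMatrix.mulVec n + c.shifted := by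
    rw [← hn]
    funext v
    simp only [Label.shifted, Pi.add_apply, Pi.sub_apply]
    ring
  ext ℓ
  simp only [thetaIndex, Set.mem_ofPred_eq, hs]
  constructor
  · rintro (⟨m, rfl⟩ | ⟨m, rfl⟩)
    · exact Or.inl ⟨m + n, by rw [Matrix.mulVec_add, smul_add, add_assoc]⟩
    · exact Or.inr ⟨m - n, by rw [Matrix.mulVec_sub, smul_sub]; abel⟩
  · rintro (⟨m, rfl⟩ | ⟨m, rfl⟩)
    · exact Or.inl ⟨m - n, by rw [Matrix.mulVec_sub, smul_sub]; abel⟩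
    · exact Or.inr ⟨m + n, by rw [Matrix.mulVec_add, smul_add]; abel⟩

/-- The defect `Ẑ`-invariant as a function of the `Spin^c` structure and `τ`. -/
def zhat (s : P.SpinC) (τ : ℍ) : ℂ :=
  Quotient.lift (fun b : P.Label => P.zhatLabel b τ)
    (fun b c h => by
      have h' := P.thetaIndex_congr h
      simp only [zhatLabel]
      rw [h']) s

end Zhat

/-! ### Neumann (3d Kirby) moves on plumbing trees

In each move the new nodes carry no defect and the defects of the old nodes are kept. The
transport maps describe the induced identification of the shifted labels `b + ν`. -/

section Moves

variable (P : DefectPlumbing.{u})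

/-- The nodes on the `v`-side of the edge `uv`. -/
def sideOf (u v : P.V) : Set P.V := {x | (P.graph.deleteEdges {s(u, v)}).Reachable v x}

open scoped Classical in
/-- Blow-up of the edge `uv` by `ε = ±1`: the edge is replaced by `u - new - v`, the new node has
weight `ε`, and `ε` is added to the weights of `u` and `v`. -/
def edgeBlowUp (u v : P.V) (ε : ℤˣ) : DefectPlumbing.{u} where
  V := Option P.V
  graph := SimpleGraph.fromRel fun x y =>
    match x, y with
    | some x, some y => P.graph.Adj x y ∧ s(x, y) ≠ s(u, v)
    | none, some y => y = u ∨ y = v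
    | _, none => False
  weight x :=
    match x with
    | some x => P.weight x + if x = u ∨ x = v then (ε : ℤ) else 0
    | none => (ε : ℤ)
  nu x :=
    match x with
    | some x => P.nu x
    | none => 0

open scoped Classical in
/-- Labels under the blow-up of the edge `uv`: multiplied by `-ε` on the side of `v`, unchanged on
the side of `u`, zero at the new node. -/
def edgeTransport (u v : P.V) (ε : ℤˣ) (β : P.V → ℤ) : Option P.V → ℤ
  | some x => if x ∈ P.sideOf u v then -(ε : ℤ) * β x else β x
  | none => 0

open scoped Classical in
/-- Blow-up at the node `v` by `ε = ±1`: a new leaf of weight `ε` is attached to `v`, and `ε` is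
added to the weight of `v`. -/
def leafBlowUp (v : P.V) (ε : ℤˣ) : DefectPlumbing.{u} where
  V := Option P.V
  graph := SimpleGraph.fromRel fun x y =>
    match x, y with
    | some x, some y => P.graph.Adj x y
    | none, some y => y = v
    | _, none => False
  weight x :=
    match x with
    | some x => P.weight x + if x = v then (ε : ℤ) else 0
    | none => (ε : ℤ)
  nu x :=
    match x with
    | some x => P.nu x
    | none => 0

open scoped Classical in
/-- Labels under the blow-up at the node `v`. -/
def leafTransport (v : P.V) (ε : ℤˣ) (β : P.V → ℤ) : Option P.V → ℤ
  | some x => if x = v then β x + 1 else β x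
  | none => (ε : ℤ)

open scoped Classical in
/-- `0`-chain extrusion at `w`, the inverse of `0`-chain absorption: `w` is replaced by a chain
`w - n₀ - n₁` with weights `a_w - c, 0, c`, where `n₀ = inr false` and `n₁ = inr true`, and the
neighbours of `w` belonging to `N` are attached to `n₁` instead of `w`. -/
def zeroChain (w : P.V) (N : Set P.V) (c : ℤ) : DefectPlumbing.{u} where
  V := P.V ⊕ Bool
  graph := SimpleGraph.fromRel fun x y =>
    match x, y with
    | Sum.inl x, Sum.inl y => P.graph.Adj x y ∧ ¬(x = w ∧ y ∈ N) ∧ ¬(y = w ∧ x ∈ N)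
    | Sum.inl x, Sum.inr false => x = w
    | Sum.inl x, Sum.inr true => x ∈ N
    | Sum.inr false, Sum.inr true => True
    | _, _ => False
  weight x :=
    match x with
    | Sum.inl x => if x = w then P.weight x - c else P.weight x
    | Sum.inr false => 0
    | Sum.inr true => c
  nu x :=
    match x with
    | Sum.inl x => P.nu x
    | Sum.inr _ => 0

open scoped Classical in
/-- Labels under `0`-chain extrusion: with `k = |N| + 1` the degree of `n₁`, `β_w` becomes
`β_w + k`, the new nodes `n₀, n₁` get `0, k`, and the sign is changed on the branches at `w` that
are moved to `n₁`. -/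
def zeroChainTransport (w : P.V) (N : Set P.V) (β : P.V → ℤ) : P.V ⊕ Bool → ℤ
  | Sum.inl x =>
      if x = w then β x + ((N.ncard : ℤ) + 1)
      else if ∃ y ∈ N, x ∈ P.sideOf w y then -β x else β x
  | Sum.inr false => 0
  | Sum.inr true => (N.ncard : ℤ) + 1

end Moves

/-- `KirbyMove P Q T`: `Q` arises from `P` by a Neumann move (or an isomorphism of decorated
plumbing graphs), with induced map `T` on the shifted labels. The moves in the opposite direction
(blow-downs and `0`-chain absorption) are the inverses of these. -/
inductive KirbyMove :
    (P Q : DefectPlumbing.{u}) → ((P.V → ℤ) → (Q.V → ℤ)) → Prop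
  | edge (P : DefectPlumbing.{u}) (u v : P.V) (h : P.graph.Adj u v) (ε : ℤˣ) :
      KirbyMove P (P.edgeBlowUp u v ε) (P.edgeTransport u v ε)
  | leaf (P : DefectPlumbing.{u}) (v : P.V) (ε : ℤˣ) :
      KirbyMove P (P.leafBlowUp v ε) (P.leafTransport v ε)
  | chain (P : DefectPlumbing.{u}) (w : P.V) (N : Set P.V) (hN : N ⊆ P.graph.neighborSet w)
      (c : ℤ) : KirbyMove P (P.zeroChain w N c) (P.zeroChainTransport w N)
  | iso (P Q : DefectPlumbing.{u}) (e : P.graph ≃g Q.graph)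
      (hweight : ∀ v, Q.weight (e v) = P.weight v) (hnu : ∀ v, Q.nu (e v) = P.nu v) :
      KirbyMove P Q (fun β x => β (e.symm x))

end DefectPlumbing

/-- A decorated plumbing graph together with a `Spin^c` structure. -/
structure SpinPlumbing : Type (u + 1) where
  plumbing : DefectPlumbing.{u}
  spin : plumbing.SpinC

/-- A move between weakly negative plumbing trees matching the given `Spin^c` structures. -/
def SpinPlumbing.Step (X Y : SpinPlumbing.{u}) : Prop :=
  X.plumbing.IsWeaklyNegativeTree ∧ Y.plumbing.IsWeaklyNegativeTree ∧
    ∃ T, DefectPlumbing.KirbyMove X.plumbing Y.plumbing T ∧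
      ∃ (b : X.plumbing.Label) (b' : Y.plumbing.Label),
        b.toSpinC = X.spin ∧ b'.toSpinC = Y.spin ∧ b'.shifted = T b.shifted

end

/-! Integrating term by term separates the variables. The contribution of `ℓ` is `q^{-ℓᵀM⁻¹ℓ/4}`
times a product over nodes of `pvCoeff (2 - deg v) (ν v) (ℓ v)`. This factor is the coefficient of
`z^{-ℓ}` in `(z - 1/z)^{2 - deg v} χ_ν(z)`, averaged over the Laurent expansions on the two sides of
the unit circle.

Convergence. If `deg v ≤ 2` the kernel at `v` is a Laurent polynomial, so `ℓ v` is confined to a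
bounded range. On the span of the remaining nodes `M⁻¹` is negative definite, so `|q^{-ℓᵀM⁻¹ℓ/4}|`
decays like a Gaussian, which beats the at most exponential growth of the coefficients.

Invariance. Every move is an `Extension`: up to signs `s` on the old nodes, the new matrix is an
integral unimodular change of basis of `M ⊕ B`, where the block `B` is `(ε)`, `(ε)`, `[[0,1],[1,c]]`
or empty. Hence signatures add, the form of the inverse matrix splits as `yᵀM⁻¹y + tᵀB⁻¹t`, and
`2Bℤ^E = 2ℤ^E`. The `Spin^c` sets are therefore in bijection, and the new theta index set is the old
one times a parity class of vectors `t` on the new nodes. Invariance reduces to `LocalIdentity`, a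
sum over `t` alone, whose constant must cancel the change of prefactor.

A new node of degree 2 has kernel 1 and forces `t = 0`. A new leaf has kernel `z - 1/z`, and its two
terms realise the recursion from exponent `1 - deg v` to `2 - deg v`. For a `0`-chain, the sum over
the label of `n₁` convolves the coefficients at `n₁` and `w`, and should give those of the merged
node. Principal values are not multiplicative in general, but they are if one factor is a Laurent
polynomial, that is, if `n₁` or `w` has degree at most 2. Weak negativity guarantees this: the
vector `e_w + e_{n₁}` is isotropic for the new inverse matrix, so both nodes cannot have degree at
least 3.

On a tree the sign changes on branches cost a factor that can be read off the edges where the sign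
jumps; it combines with `(-1)^π`. -/

noncomputable section

/-! ### Laurent coefficients of one-variable kernels -/

/-- The one-variable integrand `(z - z⁻¹)^n χ_ν(z) z^ℓ`. -/
def pvKernel (n : ℤ) (ν : ℕ) (ℓ : ℤ) (z : ℂ) : ℂ :=
  (z - z⁻¹) ^ n * sl2Char ν z * z ^ ℓ

/-- The principal value of `(z - z⁻¹)^n χ_ν(z) z^ℓ dz / (2πiz)`, computed with the radii `2` and
`1/2`. -/
def pvCoeff (n : ℤ) (ν : ℕ) (ℓ : ℤ) : ℂ :=
  2⁻¹ * (Real.circleAverage (pvKernel n ν ℓ) 0 2 + Real.circleAverage (pvKernel n ν ℓ) 0 2⁻¹)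

theorem sub_inv_ne_zero_of_norm {z : ℂ} (h0 : z ≠ 0) (h1 : ‖z‖ ≠ 1) : z - z⁻¹ ≠ 0 := by
  intro h
  apply h1
  have h2 : z * z = 1 := by
    have := sub_eq_zero.mp h
    nth_rewrite 2 [this]
    exact mul_inv_cancel₀ h0
  have h3 : ‖z‖ * ‖z‖ = 1 := by rw [← norm_mul, h2, norm_one]
  nlinarith [norm_nonneg z]

theorem differentiableAt_pvKernel (n : ℤ) (ν : ℕ) (ℓ : ℤ) {z : ℂ} (h0 : z ≠ 0) (h1 : ‖z‖ ≠ 1) :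
    DifferentiableAt ℂ (pvKernel n ν ℓ) z := by
  have h2 := sub_inv_ne_zero_of_norm h0 h1
  unfold pvKernel sl2Char
  refine DifferentiableAt.mul (DifferentiableAt.mul ?_ ?_) (differentiableAt_id.zpow (Or.inl h0))
  · exact (differentiableAt_id.sub (differentiableAt_inv h0)).zpow (Or.inl h2)
  · exact DifferentiableAt.fun_sum fun k _ => differentiableAt_id.zpow (Or.inl h0)

theorem circleIntegrable_pvKernel (n : ℤ) (ν : ℕ) (ℓ : ℤ) {r : ℝ} (h0 : 0 < r) (h1 : r ≠ 1) :
    CircleIntegrable (pvKernel n ν ℓ) 0 r := by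
  refine ContinuousOn.circleIntegrable h0.le fun z hz => ?_
  have hz' : ‖z‖ = r := by simpa using hz
  exact (differentiableAt_pvKernel n ν ℓ (by rw [← norm_pos_iff, hz']; exact h0)
    (by rwa [hz'])).continuousAt.continuousWithinAt

/-- Cauchy's theorem on an annulus: the kernel is holomorphic away from `0` and the unit circle, so
only crossing radius 1 can change the average. -/
theorem circleAverage_pvKernel_eq (n : ℤ) (ν : ℕ) (ℓ : ℤ) {r R : ℝ} (h0 : 0 < r) (hle : r ≤ R)
    (h1 : R < 1 ∨ 1 < r) :
    Real.circleAverage (pvKernel n ν ℓ) 0 R = Real.circleAverage (pvKernel n ν ℓ) 0 r := by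
  have key : ∀ z : ℂ, r ≤ ‖z‖ → ‖z‖ ≤ R → DifferentiableAt ℂ (pvKernel n ν ℓ) z := by
    intro z hr hR
    refine differentiableAt_pvKernel n ν ℓ (by rw [← norm_pos_iff]; linarith) ?_
    rcases h1 with h1 | h1
    · exact (lt_of_le_of_lt hR h1).ne
    · exact (lt_of_lt_of_le h1 hr).ne'
  rw [Real.circleAverage_eq_circleIntegral (h0.trans_le hle).ne',
    Real.circleAverage_eq_circleIntegral h0.ne',
    Complex.circleIntegral_sub_center_inv_smul_eq_of_differentiable_on_annulus_off_countable h0 hle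
      Set.countable_empty]
  · intro z hz
    simp only [Set.mem_sdiff, Metric.mem_closedBall, dist_zero_right, Metric.mem_ball, not_lt] at hz
    exact (key z hz.2 hz.1).continuousAt.continuousWithinAt
  · intro z hz
    simp only [Set.mem_sdiff, Metric.mem_closedBall, dist_zero_right, Metric.mem_ball, not_le,
      Set.mem_empty_iff_false, not_false_eq_true, and_true] at hz
    exact key z hz.2.le hz.1.le

/-- The half-sum of circle averages does not depend on the radii. -/
theorem half_sum_circleAverage_pvKernel (n : ℤ) (ν : ℕ) (ℓ : ℤ) {ε : ℝ} (h0 : 0 < ε)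
    (h1 : ε < 1) :
    2⁻¹ * (Real.circleAverage (pvKernel n ν ℓ) 0 (1 + ε) +
      Real.circleAverage (pvKernel n ν ℓ) 0 (1 - ε)) = pvCoeff n ν ℓ := by
  unfold pvCoeff
  rw [circleAverage_pvKernel_eq n ν ℓ (r := 1 + ε) (R := 2) (by linarith) (by linarith)
    (Or.inr (by linarith))]
  -- The inner radius `1 - ε` may lie on either side of `1/2`; the annulus stays inside the unit
  -- disc in both cases.
  rcases le_total (1 - ε) 2⁻¹ with h | h
  · rw [circleAverage_pvKernel_eq n ν ℓ (r := 1 - ε) (R := 2⁻¹) (by linarith) h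
      (Or.inl (by norm_num))]
  · rw [circleAverage_pvKernel_eq n ν ℓ (r := 2⁻¹) (R := 1 - ε) (by norm_num) h
      (Or.inl (by linarith))]

theorem circleAverage_sub_pvKernel (n : ℤ) (ν : ℕ) (ℓ : ℤ) {r : ℝ} (h0 : 0 < r) (h1 : r ≠ 1) :
    Real.circleAverage (pvKernel (n + 1) ν ℓ) 0 r =
      Real.circleAverage (pvKernel n ν (ℓ + 1)) 0 r -
        Real.circleAverage (pvKernel n ν (ℓ - 1)) 0 r := by
  rw [← Real.circleAverage_fun_sub (circleIntegrable_pvKernel n ν _ h0 h1)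
    (circleIntegrable_pvKernel n ν _ h0 h1)]
  refine Real.circleAverage_congr_sphere fun z hz => ?_
  have hz' : ‖z‖ = r := by simpa [abs_of_pos h0] using hz
  have hz0 : z ≠ 0 := by rw [← norm_pos_iff, hz']; exact h0
  have h2 := sub_inv_ne_zero_of_norm hz0 (by rwa [hz'])
  simp only [pvKernel]
  rw [zpow_add_one₀ h2, zpow_add_one₀ hz0, zpow_sub_one₀ hz0]
  ring

/-- One factor `z - z⁻¹` is split off and absorbed into `z^ℓ`. This recursion holds for negative
exponents too, and all later identities rest on it. -/
theorem pvCoeff_add_one (n : ℤ) (ν : ℕ) (ℓ : ℤ) :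
    pvCoeff (n + 1) ν ℓ = pvCoeff n ν (ℓ + 1) - pvCoeff n ν (ℓ - 1) := by
  unfold pvCoeff
  rw [circleAverage_sub_pvKernel n ν ℓ (by norm_num) (by norm_num),
    circleAverage_sub_pvKernel n ν ℓ (by norm_num) (by norm_num)]
  ring

/-- The character is a sum of monomials, each of which only shifts `ℓ`; questions about a defect
reduce to `ν = 0`. -/
theorem pvCoeff_eq_sum (n : ℤ) (ν : ℕ) (ℓ : ℤ) :
    pvCoeff n ν ℓ = ∑ k ∈ Finset.range (ν + 1), pvCoeff n 0 (ℓ + (ν - 2 * k)) := by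
  have key : ∀ r : ℝ, 0 < r → r ≠ 1 → Real.circleAverage (pvKernel n ν ℓ) 0 r =
      ∑ k ∈ Finset.range (ν + 1), Real.circleAverage (pvKernel n 0 (ℓ + (ν - 2 * k))) 0 r := by
    intro r h0 h1
    rw [← Real.circleAverage_fun_sum fun k _ => circleIntegrable_pvKernel n 0 _ h0 h1]
    refine Real.circleAverage_congr_sphere fun z hz => ?_
    have hz' : ‖z‖ = r := by simpa [abs_of_pos h0] using hz
    have hz0 : z ≠ 0 := by rw [← norm_pos_iff, hz']; exact h0
    simp only [pvKernel, sl2Char, Finset.mul_sum, Finset.sum_mul]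
    refine Finset.sum_congr rfl fun k _ => ?_
    rw [zpow_add₀ hz0]
    simp
    ring
  simp only [pvCoeff]
  rw [key 2 (by norm_num) (by norm_num), key 2⁻¹ (by norm_num) (by norm_num),
    ← Finset.sum_add_distrib, Finset.mul_sum]

theorem sl2Char_inv (ν : ℕ) (z : ℂ) : sl2Char ν z⁻¹ = sl2Char ν z := by
  unfold sl2Char
  rw [← Finset.sum_range_reflect]
  refine Finset.sum_congr rfl fun k hk => ?_
  have hk' : k ≤ ν := by simpa [Nat.lt_succ_iff] using hk
  rw [inv_zpow', Nat.add_sub_cancel, Nat.cast_sub hk']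
  congr 1
  ring

theorem pvKernel_inv (n : ℤ) (ν : ℕ) (ℓ : ℤ) (z : ℂ) :
    pvKernel n ν ℓ z⁻¹ = (-1) ^ n * pvKernel n ν (-ℓ) z := by
  unfold pvKernel
  rw [sl2Char_inv, inv_inv, inv_zpow', ← neg_sub z z⁻¹, neg_eq_neg_one_mul, mul_zpow]
  ring

theorem circleAverage_inv (f : ℂ → ℂ) {r : ℝ} :
    Real.circleAverage (fun z => f z⁻¹) 0 r = Real.circleAverage f 0 r⁻¹ := by
  rw [Real.circleAverage_eq_circleAverage_zero_one, Real.circleAverage_eq_circleAverage_zero_one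
    (R := r⁻¹), ← Real.circleAverage_zero_one_congr_inv (f := fun z => f (((r⁻¹ : ℝ) : ℂ) * z + 0))]
  congr 1
  ext z
  simp [mul_comm]

/-- The substitution `z ↦ 1/z` fixes the character, negates `z - 1/z` and exchanges the circles of
radius `2` and `1/2`. The half-sum is symmetric under the exchange, so it has a parity that neither
one-sided expansion has. -/
theorem pvCoeff_neg (n : ℤ) (ν : ℕ) (ℓ : ℤ) :
    pvCoeff n ν (-ℓ) = (-1) ^ n * pvCoeff n ν ℓ := by
  have key : ∀ r : ℝ, Real.circleAverage (pvKernel n ν (-ℓ)) 0 r =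
      (-1) ^ n * Real.circleAverage (pvKernel n ν ℓ) 0 r⁻¹ := by
    intro r
    rw [← circleAverage_inv, ← smul_eq_mul, ← Real.circleAverage_fun_smul]
    congr 1
    ext z
    rw [pvKernel_inv, smul_eq_mul, ← mul_assoc, ← mul_zpow]
    simp
  unfold pvCoeff
  rw [key, key, inv_inv]
  ring

theorem circleAverage_zpow {ℓ : ℤ} (hℓ : ℓ ≠ 0) {r : ℝ} (h0 : 0 < r) :
    Real.circleAverage (fun z : ℂ => z ^ ℓ) 0 r = 0 := by
  rw [Real.circleAverage_eq_circleIntegral h0.ne']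
  have : (∮ z in C(0, r), (z - 0)⁻¹ • z ^ ℓ) = ∮ z in C(0, r), (z - 0) ^ (ℓ - 1) := by
    refine circleIntegral.integral_congr h0.le fun z hz => ?_
    have hz' : ‖z‖ = r := by simpa using hz
    have hz0 : z ≠ 0 := by rw [← norm_pos_iff, hz']; exact h0
    simp [zpow_sub_one₀ hz0, mul_comm]
  rw [this, circleIntegral.integral_sub_zpow_of_ne (by omega), smul_zero]

theorem pvCoeff_zero_zero (ℓ : ℤ) : pvCoeff 0 0 ℓ = if ℓ = 0 then 1 else 0 := by
  have h : pvKernel 0 0 ℓ = fun z : ℂ => z ^ ℓ := by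
    ext z
    simp [pvKernel, sl2Char]
  unfold pvCoeff
  rw [h]
  split_ifs with hℓ
  · subst hℓ
    simp [Real.circleAverage_const]
    norm_num
  · rw [circleAverage_zpow hℓ (by norm_num), circleAverage_zpow hℓ (by norm_num)]
    simp

theorem pvCoeff_one_zero (ℓ : ℤ) :
    pvCoeff 1 0 ℓ = (if ℓ = -1 then 1 else 0) - (if ℓ = 1 then 1 else 0) := by
  have h := pvCoeff_add_one 0 0 ℓ
  rw [zero_add] at h
  rw [h, pvCoeff_zero_zero, pvCoeff_zero_zero]
  congr 1
  · simp only [add_eq_zero_iff_eq_neg]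
  · simp only [sub_eq_zero]

/-- Nonnegative powers give Laurent polynomials. -/
theorem pvCoeff_natCast_eq_zero (n ν : ℕ) (ℓ : ℤ) (h : (n : ℤ) + ν < |ℓ|) :
    pvCoeff n ν ℓ = 0 := by
  induction n generalizing ℓ with
  | zero =>
    rw [pvCoeff_eq_sum]
    refine Finset.sum_eq_zero fun k hk => ?_
    have hk' : k ≤ ν := by simpa [Nat.lt_succ_iff] using hk
    have : ℓ + ((ν : ℤ) - 2 * k) ≠ 0 := by
      intro h0
      rcases abs_cases ℓ with h1 | h1 <;> omega
    simp only [Nat.cast_zero]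
    rw [pvCoeff_zero_zero, if_neg this]
  | succ n ih =>
    push_cast at h ⊢
    rw [pvCoeff_add_one, ih, ih, sub_zero]
    · rcases abs_cases ℓ with h1 | h1 <;> rcases abs_cases (ℓ - 1) with h2 | h2 <;> omega
    · rcases abs_cases ℓ with h1 | h1 <;> rcases abs_cases (ℓ + 1) with h2 | h2 <;> omega

theorem exists_norm_circleAverage_pvKernel_le (n : ℤ) (ν : ℕ) {r : ℝ} (h0 : 0 < r) (h1 : r ≠ 1) :
    ∃ C : ℝ, 0 ≤ C ∧ ∀ ℓ : ℤ, ‖Real.circleAverage (pvKernel n ν ℓ) 0 r‖ ≤ C * r ^ ℓ := by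
  have hcont : ContinuousOn (pvKernel n ν 0) (Metric.sphere 0 r) := by
    intro z hz
    have hz' : ‖z‖ = r := by simpa using hz
    exact (differentiableAt_pvKernel n ν 0 (by rw [← norm_pos_iff, hz']; exact h0)
      (by rwa [hz'])).continuousAt.continuousWithinAt
  obtain ⟨C, hC⟩ := (isCompact_sphere (0 : ℂ) r).exists_bound_of_continuousOn hcont
  have hC0 : 0 ≤ C :=
    (norm_nonneg _).trans (hC (r : ℂ) (by simp [abs_of_pos h0]))
  refine ⟨C, hC0, fun ℓ => ?_⟩
  have hbound : ‖∫ θ in (0 : ℝ)..2 * Real.pi, pvKernel n ν ℓ (circleMap 0 r θ)‖ ≤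
      C * r ^ ℓ * |2 * Real.pi - 0| := by
    refine intervalIntegral.norm_integral_le_of_norm_le_const fun θ _ => ?_
    have hm := circleMap_mem_sphere (0 : ℂ) h0.le θ
    have h2 := hC _ hm
    have hz' : ‖circleMap 0 r θ‖ = r := by simpa using hm
    have : pvKernel n ν ℓ (circleMap 0 r θ) =
        pvKernel n ν 0 (circleMap 0 r θ) * (circleMap 0 r θ) ^ ℓ := by
      simp [pvKernel]
    rw [this, norm_mul, norm_zpow, hz']
    gcongr
  have hpi : 0 < 2 * Real.pi := Real.two_pi_pos
  rw [Real.circleAverage_def, norm_smul, Real.norm_of_nonneg (inv_nonneg.mpr hpi.le)]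
  rw [sub_zero, abs_of_pos hpi] at hbound
  rw [inv_mul_le_iff₀ hpi]
  linarith

/-- A crude exponential bound, read off from the radii `2` and `1/2`; it suffices against Gaussian
decay. -/
theorem exists_norm_pvCoeff_le (n : ℤ) (ν : ℕ) :
    ∃ C : ℝ, 0 ≤ C ∧ ∀ ℓ : ℤ, ‖pvCoeff n ν ℓ‖ ≤ C * 2 ^ |ℓ| := by
  obtain ⟨C, hC, h⟩ := exists_norm_circleAverage_pvKernel_le n ν (r := 2) (by norm_num)
    (by norm_num)
  obtain ⟨D, hD, h'⟩ := exists_norm_circleAverage_pvKernel_le n ν (r := 2⁻¹) (by norm_num)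
    (by norm_num)
  refine ⟨C + D, add_nonneg hC hD, fun ℓ => ?_⟩
  have e1 : (2 : ℝ) ^ ℓ ≤ 2 ^ |ℓ| := zpow_le_zpow_right₀ (by norm_num) (le_abs_self ℓ)
  have e2 : (2⁻¹ : ℝ) ^ ℓ ≤ 2 ^ |ℓ| := by
    rw [inv_zpow']
    exact zpow_le_zpow_right₀ (by norm_num) (neg_le_abs ℓ)
  have e3 : (0 : ℝ) ≤ 2 ^ |ℓ| := by positivity
  unfold pvCoeff
  calc ‖(2⁻¹ : ℂ) * (Real.circleAverage (pvKernel n ν ℓ) 0 2 +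
        Real.circleAverage (pvKernel n ν ℓ) 0 2⁻¹)‖
      = 2⁻¹ * ‖Real.circleAverage (pvKernel n ν ℓ) 0 2 +
        Real.circleAverage (pvKernel n ν ℓ) 0 2⁻¹‖ := by rw [norm_mul]; norm_num
    _ ≤ 2⁻¹ * (C * 2 ^ |ℓ| + D * 2 ^ |ℓ|) := by
        gcongr
        exact (norm_add_le _ _).trans (add_le_add
          ((h ℓ).trans (by gcongr)) ((h' ℓ).trans (by gcongr)))
    _ ≤ (C + D) * 2 ^ |ℓ| := by
        have := mul_nonneg (add_nonneg hC hD) e3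
        linarith

/-! ### Convolution identities -/

theorem pvCoeff_zero_eq_sum (ν : ℕ) (ℓ : ℤ) :
    pvCoeff 0 ν ℓ = ∑ k ∈ Finset.range (ν + 1), if ℓ + (ν - 2 * k) = 0 then 1 else 0 := by
  rw [pvCoeff_eq_sum]
  simp only [pvCoeff_zero_zero]

/-! ### Principal value integrals of product functions -/

/-- Fubini on the torus, after rewriting Lebesgue measure on the cube as a product measure. -/
theorem torusMean_prod {V : Type u} [Fintype V] (r : V → ℝ) (g : V → ℂ → ℂ) :
    torusMean r (fun z => ∏ v, g v (z v)) = ∏ v, Real.circleAverage (g v) 0 (r v) := by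
  unfold torusMean
  have h : (MeasureTheory.volume : MeasureTheory.Measure (V → ℝ)).restrict
      (Set.Icc (0 : V → ℝ) (fun _ => 2 * Real.pi)) =
      MeasureTheory.Measure.pi fun _ =>
        (MeasureTheory.volume : MeasureTheory.Measure ℝ).restrict (Set.Icc 0 (2 * Real.pi)) := by
    rw [← Set.pi_univ_Icc, MeasureTheory.volume_pi, MeasureTheory.Measure.restrict_pi_pi]
    rfl
  rw [h, MeasureTheory.integral_fintype_prod_eq_prod
    (f := fun v (θ : ℝ) => g v ((r v : ℂ) * Complex.exp ((θ : ℂ) * Complex.I))),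
    Fintype.card, ← Finset.prod_const, ← Finset.prod_mul_distrib]
  refine Finset.prod_congr rfl fun v _ => ?_
  rw [Real.circleAverage_def, MeasureTheory.integral_Icc_eq_integral_Ioc,
    ← intervalIntegral.integral_of_le Real.two_pi_pos.le]
  simp [circleMap]

theorem vpApprox_prod {V : Type u} [Fintype V] (g : V → ℂ → ℂ) (ε : ℝ) :
    vpApprox (fun z => ∏ v, g v (z v)) ε =
      ∏ v, 2⁻¹ * (Real.circleAverage (g v) 0 (1 + ε) + Real.circleAverage (g v) 0 (1 - ε)) := by
  classical
  unfold vpApprox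
  rw [Finset.prod_mul_distrib, Finset.prod_const]
  congr 1
  -- The sum over all choices of sides is the expansion of a product of two-term sums, one for each
  -- variable.
  have h := Finset.prod_univ_sum (fun _ : V => (Finset.univ : Finset ℤˣ))
    (fun v s => Real.circleAverage (g v) 0 (1 + (((s : ℤˣ) : ℤ) : ℝ) * ε))
  rw [Fintype.piFinset_univ] at h
  convert h.symm using 1
  · exact Finset.sum_congr (by ext; simp) fun s _ => torusMean_prod _ _
  · refine Finset.prod_congr rfl fun v _ => ?_
    rw [UnitsInt.univ, Finset.sum_pair (by decide)]
    simp [sub_eq_add_neg]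

namespace DefectPlumbing

variable (P : DefectPlumbing.{u})

theorem kernel_mul_thetaTerm (τ : ℍ) (ℓ : P.V → ℤ) :
    (fun z => P.kernel z * P.thetaTerm τ ℓ z) = fun z =>
      qPow τ (-(P.invForm fun v => (ℓ v : ℝ)) / 4) *
        ∏ v, pvKernel (2 - (P.deg v : ℤ)) (P.nu v) (ℓ v) (z v) := by
  ext z
  simp only [kernel, thetaTerm, pvKernel, Finset.prod_mul_distrib]
  ring

theorem vpApprox_const_mul {V : Type u} [Fintype V] (c : ℂ) (f : (V → ℂ) → ℂ) (ε : ℝ) :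
    vpApprox (fun z => c * f z) ε = c * vpApprox f ε := by
  simp only [vpApprox, torusMean, MeasureTheory.integral_const_mul, Finset.mul_sum]
  exact Finset.sum_congr rfl fun s _ => by ring

/-- The limit is trivial: the approximations are constant for `0 < ε < 1`. -/
theorem tendsto_vpApprox (τ : ℍ) (ℓ : P.V → ℤ) :
    Filter.Tendsto (vpApprox fun z => P.kernel z * P.thetaTerm τ ℓ z) (𝓝[>] (0 : ℝ))
      (𝓝 (qPow τ (-(P.invForm fun v => (ℓ v : ℝ)) / 4) *
        ∏ v, pvCoeff (2 - (P.deg v : ℤ)) (P.nu v) (ℓ v))) := by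
  refine tendsto_const_nhds.congr' ?_
  filter_upwards [Ioo_mem_nhdsGT (zero_lt_one : (0 : ℝ) < 1)] with ε hε
  rw [kernel_mul_thetaTerm, vpApprox_const_mul, vpApprox_prod]
  simp only [half_sum_circleAverage_pvKernel _ _ _ hε.1 hε.2]

theorem zhatTerm_eq (τ : ℍ) (ℓ : P.V → ℤ) :
    P.zhatTerm τ ℓ = qPow τ (-(P.invForm fun v => (ℓ v : ℝ)) / 4) *
        ∏ v, pvCoeff (2 - (P.deg v : ℤ)) (P.nu v) (ℓ v) :=
  (P.tendsto_vpApprox τ ℓ).limUnder_eq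

end DefectPlumbing

/-! ### Absolute convergence -/

/-- A finite set of vectors sits in the box of its coordinate projections, over which the sum
factors; this bounds all partial sums by the product of the one-variable sums. -/
theorem summable_prod_pi {ι : Type u} [Fintype ι] {α : Type*} (f : ι → α → ℝ)
    (h0 : ∀ i a, 0 ≤ f i a) (hf : ∀ i, Summable (f i)) :
    Summable fun x : ι → α => ∏ i, f i (x i) := by
  classical
  refine summable_of_sum_le (fun x => Finset.prod_nonneg fun i _ => h0 i _)
    (c := ∏ i, ∑' a, f i a) fun s => ?_
  calc ∑ x ∈ s, ∏ i, f i (x i)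
      ≤ ∑ x ∈ Fintype.piFinset fun i => s.image fun x => x i, ∏ i, f i (x i) := by
        refine Finset.sum_le_sum_of_subset_of_nonneg (fun x hx => ?_) fun x _ _ =>
          Finset.prod_nonneg fun i _ => h0 i _
        exact Fintype.mem_piFinset.mpr fun i => Finset.mem_image_of_mem _ hx
    _ = ∏ i, ∑ a ∈ s.image fun x => x i, f i a := (Finset.prod_univ_sum _ _).symm
    _ ≤ ∏ i, ∑' a, f i a := Finset.prod_le_prod
        (fun i _ => Finset.sum_nonneg fun a _ => h0 i a)
        fun i _ => (hf i).sum_le_tsum _ fun a _ => h0 i a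

theorem summable_exp_neg_abs_int : Summable fun n : ℤ => Real.exp (-|(n : ℝ)|) := by
  have h : Summable fun n : ℕ => Real.exp (-(n : ℝ)) := by
    simpa using Real.summable_exp_neg_nat
  refine Summable.of_nat_of_neg ?_ ?_ <;> simpa using h

/-- A quadratic form which is negative on a nonzero coordinate subspace is bounded away from `0`
there. -/
theorem exists_pos_forall_quadratic_le {V : Type u} [Fintype V] (A : Matrix V V ℝ)
    (S : Set V) (h : ∀ x : V → ℝ, (∀ v ∈ S, x v = 0) → x ≠ 0 → x ⬝ᵥ A.mulVec x < 0) :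
    ∃ δ : ℝ, 0 < δ ∧ ∀ x : V → ℝ, (∀ v ∈ S, x v = 0) → x ⬝ᵥ A.mulVec x ≤ -δ * ‖x‖ ^ 2 := by
  set K : Set (V → ℝ) := Metric.sphere 0 1 ∩ {x | ∀ v ∈ S, x v = 0} with hK
  have hcl : IsClosed {x : V → ℝ | ∀ v ∈ S, x v = 0} := by
    have : {x : V → ℝ | ∀ v ∈ S, x v = 0} = ⋂ v ∈ S, {x | x v = 0} := by ext; simp
    rw [this]
    exact isClosed_biInter fun v _ => isClosed_eq (continuous_apply v) continuous_const
  have hcomp : IsCompact K := (isCompact_sphere _ _).inter_right hcl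
  have hcont : Continuous fun x : V → ℝ => x ⬝ᵥ A.mulVec x := by fun_prop
  have hscale : ∀ (c : ℝ) (x : V → ℝ), (c • x) ⬝ᵥ A.mulVec (c • x) = c ^ 2 * (x ⬝ᵥ A.mulVec x) := by
    intro c x
    rw [Matrix.mulVec_smul, smul_dotProduct, dotProduct_smul, smul_eq_mul, smul_eq_mul]
    ring
  obtain ⟨δ, hδ, hb⟩ : ∃ δ : ℝ, 0 < δ ∧ ∀ x ∈ K, x ⬝ᵥ A.mulVec x ≤ -δ := by
    -- The unit sphere of the subspace is empty when the subspace is zero, and then any positive `δ`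
    -- serves; otherwise the maximum over the compact sphere is attained and negative.
    rcases K.eq_empty_or_nonempty with he | hne
    · exact ⟨1, one_pos, by simp [he]⟩
    · obtain ⟨x₀, hx₀, hmax⟩ := hcomp.exists_isMaxOn hne hcont.continuousOn
      have hx0 : x₀ ≠ 0 := by
        rintro rfl
        simp [hK] at hx₀
      refine ⟨-(x₀ ⬝ᵥ A.mulVec x₀), neg_pos.mpr (h x₀ hx₀.2 hx0), fun x hx => ?_⟩
      rw [neg_neg]
      exact hmax hx
  refine ⟨δ, hδ, fun x hx => ?_⟩
  rcases eq_or_ne x 0 with rfl | hx0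
  · simp
  · have hn : ‖x‖ ≠ 0 := norm_ne_zero_iff.mpr hx0
    have hmem : ‖x‖⁻¹ • x ∈ K := by
      refine ⟨by simp [norm_smul, hn], fun v hv => ?_⟩
      simp [hx v hv]
    have h2 := hb _ hmem
    rw [hscale, inv_pow, inv_mul_le_iff₀ (by positivity)] at h2
    linarith

theorem norm_qPow (τ : ℍ) (r : ℝ) : ‖qPow τ r‖ = Real.exp (-(2 * Real.pi * τ.im * r)) := by
  unfold qPow
  rw [Complex.norm_exp]
  congr 1
  simp [Complex.mul_re, Complex.mul_im]

theorem abs_dotProduct_mulVec_le {V : Type u} [Fintype V] (A : Matrix V V ℝ) :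
    ∃ C : ℝ, 0 ≤ C ∧ ∀ x y : V → ℝ, |x ⬝ᵥ A.mulVec y| ≤ C * ‖x‖ * ‖y‖ := by
  refine ⟨∑ v, ∑ w, |A v w|, Finset.sum_nonneg fun v _ => Finset.sum_nonneg fun w _ =>
    abs_nonneg _, fun x y => ?_⟩
  simp only [dotProduct, Matrix.mulVec, Finset.mul_sum, Finset.sum_mul]
  refine (Finset.abs_sum_le_sum_abs _ _).trans (Finset.sum_le_sum fun v _ =>
    (Finset.abs_sum_le_sum_abs _ _).trans (Finset.sum_le_sum fun w _ => ?_))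
  rw [abs_mul, abs_mul]
  have h1 : |x v| ≤ ‖x‖ := norm_le_pi_norm x v
  have h2 : |y w| ≤ ‖y‖ := norm_le_pi_norm y w
  calc |x v| * (|A v w| * |y w|) ≤ ‖x‖ * (|A v w| * ‖y‖) := by gcongr
    _ = |A v w| * ‖x‖ * ‖y‖ := by ring

namespace DefectPlumbing

variable {P : DefectPlumbing.{u}}

theorem pvCoeff_eq_zero_of_deg_lt {v : P.V} (hv : P.deg v < 3) {ℓ : ℤ}
    (hℓ : (2 + P.nu v : ℤ) < |ℓ|) : pvCoeff (2 - (P.deg v : ℤ)) (P.nu v) ℓ = 0 := by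
  have h : (2 - (P.deg v : ℤ)) = ((2 - P.deg v : ℕ) : ℤ) := by omega
  rw [h]
  apply pvCoeff_natCast_eq_zero
  omega

/-- The quadratic form on the part of the lattice where the low-degree coordinates are bounded. -/
theorem IsWeaklyNegativeTree.exists_invForm_le (hP : P.IsWeaklyNegativeTree) (R : ℝ) (hR : 0 ≤ R) :
    ∃ δ b c : ℝ, 0 < δ ∧ ∀ x : P.V → ℝ, (∀ v, P.deg v < 3 → |x v| ≤ R) →
      ∃ H : ℝ, 0 ≤ H ∧ ‖x‖ ≤ H + R ∧ P.invForm x ≤ -δ * H ^ 2 + b * H + c := by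
  classical
  obtain ⟨δ, hδ, hq⟩ := exists_pos_forall_quadratic_le P.matrix⁻¹ {v | P.deg v < 3}
    (fun x hx hx0 => by
      have h := hP.neg_def x hx hx0
      unfold invForm at h
      convert h)
  obtain ⟨C, hC, hb⟩ := abs_dotProduct_mulVec_le P.matrix⁻¹
  refine ⟨δ, 2 * C * R, C * R * R, hδ, fun x hx => ?_⟩
  set h : P.V → ℝ := fun v => if P.deg v < 3 then 0 else x v with hh
  set l : P.V → ℝ := fun v => if P.deg v < 3 then x v else 0 with hl
  have hxl : x = h + l := by
    ext v
    simp only [hh, hl, Pi.add_apply]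
    split_ifs <;> simp
  -- Here `h` is the part of `x` on nodes of degree at least 3 and `l` the bounded rest. Only the
  -- `h`-`h` term is quadratic in `‖h‖`; the cross terms are linear and the `l`-`l` term is bounded.
  have hln : ‖l‖ ≤ R := by
    refine (pi_norm_le_iff_of_nonneg hR).mpr fun v => ?_
    simp only [hl]
    split_ifs with hv
    · exact hx v hv
    · simpa using hR
  refine ⟨‖h‖, norm_nonneg _, ?_, ?_⟩
  · rw [hxl]
    exact (norm_add_le _ _).trans (by gcongr)
  · have e : P.invForm x = h ⬝ᵥ P.matrix⁻¹.mulVec h + h ⬝ᵥ P.matrix⁻¹.mulVec l +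
        l ⬝ᵥ P.matrix⁻¹.mulVec h + l ⬝ᵥ P.matrix⁻¹.mulVec l := by
      have e0 : P.invForm x = x ⬝ᵥ P.matrix⁻¹.mulVec x := by
        unfold invForm
        congr!
      rw [e0, hxl, Matrix.mulVec_add, add_dotProduct, dotProduct_add, dotProduct_add]
      ring
    have h1 := hq h fun v hv => by
      have hv' : P.deg v < 3 := hv
      simp [hh, hv']
    have h2 := (le_abs_self _).trans (hb h l)
    have h3 := (le_abs_self _).trans (hb l h)
    have h4 := (le_abs_self _).trans (hb l l)
    have h5 : C * ‖h‖ * ‖l‖ ≤ C * ‖h‖ * R := by gcongr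
    have h6 : C * ‖l‖ * ‖h‖ ≤ C * R * ‖h‖ := by gcongr
    have h7 : C * ‖l‖ * ‖l‖ ≤ C * R * R := by gcongr
    rw [e]
    linarith

/-- A majorant on the whole lattice, not merely on one theta index set, so that summability passes
to every label at once. -/
theorem IsWeaklyNegativeTree.exists_norm_zhatTerm_le (hP : P.IsWeaklyNegativeTree) (τ : ℍ) :
    ∃ C : ℝ, ∀ ℓ : P.V → ℤ, ‖P.zhatTerm τ ℓ‖ ≤ C * ∏ v, Real.exp (-|(ℓ v : ℝ)|) := by
  classical
  choose D hD hDb using fun v : P.V => exists_norm_pvCoeff_le (2 - (P.deg v : ℤ)) (P.nu v)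
  set R : ℝ := ∑ v : P.V, (2 + P.nu v : ℝ) with hRdef
  have hR : 0 ≤ R := Finset.sum_nonneg fun v _ => by positivity
  have hRv : ∀ v, (2 + P.nu v : ℝ) ≤ R := fun v =>
    Finset.single_le_sum (f := fun v : P.V => (2 + P.nu v : ℝ)) (fun v _ => by positivity)
      (Finset.mem_univ v)
  obtain ⟨δ, b, c, hδ, hform⟩ := hP.exists_invForm_le R hR
  set α : ℝ := Real.pi * τ.im / 2 with hα
  have hα0 : 0 < α := by have := τ.im_pos; positivity
  set n : ℝ := (Fintype.card P.V : ℝ) with hn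
  -- The maximum over `H` of `α(-δH² + bH + c) + 2n(H + R)`. Of the two copies of `∑|ℓ v| ≤ n(H +
  -- R)`, one pays for the growth of the coefficients and the other supplies the decay of the
  -- majorant.
  set E : ℝ := (α * b + 2 * n) ^ 2 / (4 * (α * δ)) + α * c + 2 * n * R with hE
  refine ⟨(∏ v, D v) * Real.exp E, fun ℓ => ?_⟩
  by_cases hlow : ∀ v, P.deg v < 3 → |((ℓ v : ℤ) : ℝ)| ≤ R
  · obtain ⟨H, hH, hxn, hf⟩ := hform (fun v => (ℓ v : ℝ)) hlow
    have hS : ∑ v, |(ℓ v : ℝ)| ≤ n * (H + R) := by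
      calc ∑ v, |(ℓ v : ℝ)| ≤ ∑ _v : P.V, (H + R) :=
            Finset.sum_le_sum fun v _ =>
              (norm_le_pi_norm (fun v => (ℓ v : ℝ)) v).trans hxn
        _ = n * (H + R) := by rw [Finset.sum_const, nsmul_eq_mul, Finset.card_univ]
    have hquad : -(α * δ) * H ^ 2 + (α * b + 2 * n) * H ≤
        (α * b + 2 * n) ^ 2 / (4 * (α * δ)) := by
      have : 0 < α * δ := mul_pos hα0 hδ
      rw [le_div_iff₀ (by positivity)]
      nlinarith [sq_nonneg (2 * (α * δ) * H - (α * b + 2 * n))]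
    have hexp : α * P.invForm (fun v => (ℓ v : ℝ)) + ∑ v, |(ℓ v : ℝ)| ≤
        E + -∑ v, |(ℓ v : ℝ)| := by
      have := mul_le_mul_of_nonneg_left hf hα0.le
      rw [hE]
      linarith
    rw [zhatTerm_eq, norm_mul, norm_qPow, norm_prod]
    have hq : -(2 * Real.pi * τ.im * (-P.invForm (fun v => (ℓ v : ℝ)) / 4)) =
        α * P.invForm (fun v => (ℓ v : ℝ)) := by rw [hα]; ring
    rw [hq]
    have hprod : ∏ v, ‖pvCoeff (2 - (P.deg v : ℤ)) (P.nu v) (ℓ v)‖ ≤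
        (∏ v, D v) * Real.exp (∑ v, |(ℓ v : ℝ)|) := by
      rw [Real.exp_sum, ← Finset.prod_mul_distrib]
      refine Finset.prod_le_prod (fun _ _ => norm_nonneg _) fun v _ => (hDb v (ℓ v)).trans ?_
      refine mul_le_mul_of_nonneg_left ?_ (hD v)
      have e2 : (2 : ℝ) ≤ Real.exp 1 := by
        have := Real.add_one_le_exp (1 : ℝ)
        linarith
      have e3 : (2 : ℝ) ^ |ℓ v| = 2 ^ (ℓ v).natAbs := by
        rw [Int.abs_eq_natAbs, zpow_natCast]
      have e4 : |(ℓ v : ℝ)| = ((ℓ v).natAbs : ℝ) := by rw [Nat.cast_natAbs, Int.cast_abs]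
      rw [e3, e4, ← mul_one (((ℓ v).natAbs : ℕ) : ℝ), Real.exp_nat_mul]
      gcongr
    calc Real.exp (α * P.invForm (fun v => (ℓ v : ℝ))) *
          ∏ v, ‖pvCoeff (2 - (P.deg v : ℤ)) (P.nu v) (ℓ v)‖
        ≤ Real.exp (α * P.invForm (fun v => (ℓ v : ℝ))) *
          ((∏ v, D v) * Real.exp (∑ v, |(ℓ v : ℝ)|)) := by gcongr
      _ = (∏ v, D v) * Real.exp (α * P.invForm (fun v => (ℓ v : ℝ)) + ∑ v, |(ℓ v : ℝ)|) := by
          rw [Real.exp_add]; ring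
      _ ≤ (∏ v, D v) * Real.exp (E + -∑ v, |(ℓ v : ℝ)|) := by
          have : 0 ≤ ∏ v, D v := Finset.prod_nonneg fun v _ => hD v
          gcongr
      _ = (∏ v, D v) * Real.exp E * ∏ v, Real.exp (-|(ℓ v : ℝ)|) := by
          rw [Real.exp_add, ← Finset.sum_neg_distrib, Real.exp_sum]; ring
  -- A low-degree coordinate beyond `R` lies outside the support of a Laurent polynomial, so the
  -- whole term vanishes.
  · push Not at hlow
    obtain ⟨v, hv, hlt⟩ := hlow
    have hz : P.zhatTerm τ ℓ = 0 := by
      rw [zhatTerm_eq, Finset.prod_eq_zero (Finset.mem_univ v), mul_zero]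
      refine pvCoeff_eq_zero_of_deg_lt hv ?_
      have := (hRv v).trans_lt hlt
      exact_mod_cast this
    rw [hz, norm_zero]
    have : 0 ≤ ∏ v, D v := Finset.prod_nonneg fun v _ => hD v
    positivity

theorem IsWeaklyNegativeTree.summable_zhatTerm (hP : P.IsWeaklyNegativeTree) (τ : ℍ) :
    Summable (P.zhatTerm τ) := by
  obtain ⟨C, hC⟩ := hP.exists_norm_zhatTerm_le τ
  refine Summable.of_norm_bounded (Summable.mul_left C ?_) hC
  exact summable_prod_pi (fun _ a => Real.exp (-|((a : ℤ) : ℝ)|)) (fun _ _ => (Real.exp_pos _).le)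
    fun _ => summable_exp_neg_abs_int

end DefectPlumbing

/-! ### Inertia -/

/-- Sylvester's law of inertia, as an inequality between diagonal forms. -/
theorem card_pos_le_of_diagonal_forms {ι κ : Type*} [Fintype ι] [Fintype κ] (d : ι → ℝ) (d' : κ → ℝ)
    [DecidablePred fun i => 0 < d i] [DecidablePred fun j => 0 < d' j]
    (L : (ι → ℝ) →ₗ[ℝ] (κ → ℝ)) (hL : ∀ x, ∑ i, d i * x i ^ 2 = ∑ j, d' j * L x j ^ 2) :
    (Finset.univ.filter fun i => 0 < d i).card ≤ (Finset.univ.filter fun j => 0 < d' j).card := by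
  classical
  rw [← Fintype.card_subtype, ← Fintype.card_subtype,
    ← Module.finrank_fintype_fun_eq_card (R := ℝ) (η := {i // 0 < d i}),
    ← Module.finrank_fintype_fun_eq_card (R := ℝ) (η := {j // 0 < d' j})]
  let ext : ({i // 0 < d i} → ℝ) →ₗ[ℝ] (ι → ℝ) :=
    { toFun := fun x i => if h : 0 < d i then x ⟨i, h⟩ else 0
      map_add' := fun x y => by ext i; by_cases h : 0 < d i <;> simp [h]
      map_smul' := fun c x => by ext i; by_cases h : 0 < d i <;> simp [h] }
  let res : (κ → ℝ) →ₗ[ℝ] ({j // 0 < d' j} → ℝ) := LinearMap.funLeft ℝ ℝ Subtype.val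
  have hext : ∀ (x : {i // 0 < d i} → ℝ) i (h : 0 < d i), ext x i = x ⟨i, h⟩ := fun x i h => by
    simp [ext, h]
  -- Extending by zero, applying `L` and projecting to the positive coordinates has trivial kernel:
  -- on a kernel vector the form is both nonnegative (source) and nonpositive (target), so it
  -- vanishes. `L` itself need not be injective.
  have hext' : ∀ (x : {i // 0 < d i} → ℝ) i, ¬ 0 < d i → ext x i = 0 := fun x i h => by
    simp [ext, h]
  refine LinearMap.finrank_le_finrank_of_injective (f := res ∘ₗ L ∘ₗ ext) ?_
  refine (injective_iff_map_eq_zero _).mpr fun x hx => ?_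
  have h1 : ∑ j, d' j * L (ext x) j ^ 2 ≤ 0 := by
    refine Finset.sum_nonpos fun j _ => ?_
    by_cases hj : 0 < d' j
    · have : L (ext x) j = 0 := congrFun hx ⟨j, hj⟩
      rw [this]; simp
    · exact mul_nonpos_of_nonpos_of_nonneg (not_lt.mp hj) (sq_nonneg _)
  have h2 : ∀ i ∈ Finset.univ, 0 ≤ d i * ext x i ^ 2 := fun i _ => by
    by_cases hi : 0 < d i
    · positivity
    · rw [hext' x i hi]; simp
  rw [← hL] at h1
  have h3 := (Finset.sum_eq_zero_iff_of_nonneg h2).mp (le_antisymm h1 (Finset.sum_nonneg h2))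
  ext ⟨i, hi⟩
  have h4 := h3 i (Finset.mem_univ i)
  rw [hext x i hi] at h4
  simpa [hi.ne'] using h4

theorem card_neg_le_of_diagonal_forms {ι κ : Type*} [Fintype ι] [Fintype κ] (d : ι → ℝ) (d' : κ → ℝ)
    [DecidablePred fun i => d i < 0] [DecidablePred fun j => d' j < 0]
    (L : (ι → ℝ) →ₗ[ℝ] (κ → ℝ)) (hL : ∀ x, ∑ i, d i * x i ^ 2 = ∑ j, d' j * L x j ^ 2) :
    (Finset.univ.filter fun i => d i < 0).card ≤ (Finset.univ.filter fun j => d' j < 0).card := by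
  classical
  have := card_pos_le_of_diagonal_forms (fun i => -d i) (fun j => -d' j) L fun x => by
    simp only [neg_mul, Finset.sum_neg_distrib, hL]
  convert this using 3 <;> simp only [neg_pos]

namespace DefectPlumbing

open scoped Classical in
/-- The eigenvalues of the plumbing matrix. -/
def eig (P : DefectPlumbing.{u}) : P.V → ℝ := P.matrix_isHermitian.eigenvalues

theorem exists_diagonalization (P : DefectPlumbing.{u}) :
    ∃ L L' : (P.V → ℝ) →ₗ[ℝ] (P.V → ℝ), (∀ x, L (L' x) = x) ∧
      ∀ x, x ⬝ᵥ P.matrix.mulVec x = ∑ i, P.eig i * L x i ^ 2 := by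
  classical
  have h := P.matrix_isHermitian.spectral_theorem
  rw [Unitary.conjStarAlgAut_apply] at h
  set U : Matrix P.V P.V ℝ := (P.matrix_isHermitian.eigenvectorUnitary : Matrix P.V P.V ℝ) with hU
  have hUU : star U * U = 1 := Unitary.coe_star_mul_self _
  refine ⟨(star U).mulVecLin, U.mulVecLin, fun x => ?_, fun x => ?_⟩
  · simp only [Matrix.mulVecLin_apply, Matrix.mulVec_mulVec, hUU, Matrix.one_mulVec]
  · have hst : star U = U.transpose := by
      rw [Matrix.star_eq_conjTranspose, Matrix.conjTranspose_eq_transpose_of_trivial]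
    have h' : P.matrix.mulVec x = U.mulVec ((Matrix.diagonal P.eig).mulVec ((star U).mulVec x)) := by
      rw [Matrix.mulVec_mulVec, Matrix.mulVec_mulVec]
      exact congrArg (fun A : Matrix P.V P.V ℝ => A.mulVec x) h
    rw [h', Matrix.dotProduct_mulVec, ← Matrix.mulVec_transpose, hst, Matrix.mulVecLin_apply]
    simp only [dotProduct, Matrix.mulVec_diagonal]
    exact Finset.sum_congr rfl fun i _ => by ring

/-- The inertia inequality is applied in both directions between the eigenvalue diagonalization and
the given one; a right inverse of `L` is enough to go back. -/
theorem numPos_numNeg_eq (P : DefectPlumbing.{u}) {κ : Type*} [Fintype κ] (d : κ → ℝ)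
    [DecidablePred fun j => 0 < d j] [DecidablePred fun j => d j < 0]
    (L : (P.V → ℝ) →ₗ[ℝ] (κ → ℝ)) (L' : (κ → ℝ) →ₗ[ℝ] (P.V → ℝ)) (hLL : ∀ x, L (L' x) = x)
    (hL : ∀ x, x ⬝ᵥ P.matrix.mulVec x = ∑ i, d i * L x i ^ 2) :
    P.numPos = (Finset.univ.filter fun j => 0 < d j).card ∧
      P.numNeg = (Finset.univ.filter fun j => d j < 0).card := by
  classical
  obtain ⟨D, D', hDD, hD⟩ := P.exists_diagonalization
  have h1 : ∀ x, ∑ i, P.eig i * x i ^ 2 = ∑ j, d j * (L ∘ₗ D') x j ^ 2 := fun x => by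
    rw [LinearMap.comp_apply, ← hL, hD, hDD]
  have h2 : ∀ x, ∑ j, d j * x j ^ 2 = ∑ i, P.eig i * (D ∘ₗ L') x i ^ 2 := fun x => by
    rw [LinearMap.comp_apply, ← hD, hL, hLL]
  have e1 : P.numPos = (Finset.univ.filter fun i => 0 < P.eig i).card := by
    unfold numPos eig
    congr!
  have e2 : P.numNeg = (Finset.univ.filter fun i => P.eig i < 0).card := by
    unfold numNeg eig
    congr!
  rw [e1, e2]
  exact ⟨le_antisymm (card_pos_le_of_diagonal_forms _ _ _ h1)
    (card_pos_le_of_diagonal_forms _ _ _ h2),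
    le_antisymm (card_neg_le_of_diagonal_forms _ _ _ h1)
    (card_neg_le_of_diagonal_forms _ _ _ h2)⟩

/-! ### Extensions of plumbing matrices by unimodular blocks -/

/-- An identification of the plumbing matrix of `Q` with the congruence transform of the plumbing
matrix of `P`, extended by a unimodular block `B`, under the unimodular matrix with blocks
`diagonal s, 0, K, 1`. The vector `t₀` is the label on the new nodes. -/
structure Extension (P Q : DefectPlumbing.{u}) (E : Type) [Fintype E] [DecidableEq E] where
  e : P.V ⊕ E ≃ Q.V
  s : P.V → ℤˣ
  K : Matrix E P.V ℤ
  B : Matrix E E ℤ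
  B' : Matrix E E ℤ
  t₀ : E → ℤ
  mul_inv : B * B' = 1
  inl_inl : ∀ x y, Q.intMatrix (e (.inl x)) (e (.inl y)) =
    s x * s y * P.intMatrix x y + (K.transpose * B * K) x y
  inl_inr : ∀ x i, Q.intMatrix (e (.inl x)) (e (.inr i)) = (K.transpose * B) x i
  inr_inl : ∀ i x, Q.intMatrix (e (.inr i)) (e (.inl x)) = (B * K) i x
  inr_inr : ∀ i j, Q.intMatrix (e (.inr i)) (e (.inr j)) = B i j
  nu_inl : ∀ x, Q.nu (e (.inl x)) = P.nu x
  nu_inr : ∀ i, Q.nu (e (.inr i)) = 0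
  -- The parity conditions under which `up` carries the labels allowed for `P`, together with `t ≡
  -- t₀` mod 2, to the labels allowed for `Q`.
  even_inl : ∀ x, Even ((Q.deg (e (.inl x)) : ℤ) - P.deg x - ∑ i, K i x * t₀ i)
  even_inr : ∀ i, Even ((Q.deg (e (.inr i)) : ℤ) - t₀ i)

namespace Extension

variable {P Q : DefectPlumbing.{u}} {E : Type} [Fintype E] [DecidableEq E] (X : Extension P Q E)

section Ring

variable {R : Type*} [CommRing R]

/-- The integral change of variables on labels. -/
def up (y : P.V → R) (t : E → R) (q : Q.V) : R :=
  Sum.elim (fun x => ((X.s x : ℤ) : R) * y x + ∑ i, (X.K i x : R) * t i) t (X.e.symm q)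

/-- The inverse transpose of `up`. -/
def down (m : P.V → R) (k : E → R) (q : Q.V) : R :=
  Sum.elim (fun x => ((X.s x : ℤ) : R) * m x)
    (fun i => k i - ∑ x, (X.K i x : R) * (((X.s x : ℤ) : R) * m x)) (X.e.symm q)

@[simp] theorem up_inl (y : P.V → R) (t : E → R) (x : P.V) :
    X.up y t (X.e (.inl x)) = ((X.s x : ℤ) : R) * y x + ∑ i, (X.K i x : R) * t i := by
  simp [up]

@[simp] theorem up_inr (y : P.V → R) (t : E → R) (i : E) : X.up y t (X.e (.inr i)) = t i := by
  simp [up]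

@[simp] theorem down_inl (y : P.V → R) (t : E → R) (x : P.V) :
    X.down y t (X.e (.inl x)) = ((X.s x : ℤ) : R) * y x := by
  simp [down]

@[simp] theorem down_inr (m : P.V → R) (k : E → R) (i : E) : X.down m k (X.e (.inr i)) =
    k i - ∑ x, (X.K i x : R) * (((X.s x : ℤ) : R) * m x) := by
  simp [down]

theorem forall_node {p : Q.V → Prop} :
    (∀ q, p q) ↔ (∀ x, p (X.e (.inl x))) ∧ ∀ i, p (X.e (.inr i)) := by
  rw [← X.e.forall_congr_right, Sum.forall]

theorem sum_node {M : Type*} [AddCommMonoid M] (f : Q.V → M) :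
    ∑ q, f q = ∑ x, f (X.e (.inl x)) + ∑ i, f (X.e (.inr i)) := by
  rw [← X.e.sum_comp, Fintype.sum_sum_type]

theorem prod_node {M : Type*} [CommMonoid M] (f : Q.V → M) :
    ∏ q, f q = (∏ x, f (X.e (.inl x))) * ∏ i, f (X.e (.inr i)) := by
  rw [← X.e.prod_comp, Fintype.prod_sum_type]

theorem sign_mul_self (x : P.V) : ((X.s x : ℤ) : R) * ((X.s x : ℤ) : R) = 1 := by
  rw [← Int.cast_mul, ← Units.val_mul, Int.units_mul_self]
  simp

theorem sign_mul_sign_mul (x : P.V) (a : R) :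
    ((X.s x : ℤ) : R) * (((X.s x : ℤ) : R) * a) = a := by
  rw [← mul_assoc, X.sign_mul_self, one_mul]

theorem up_injective {y y' : P.V → R} {t t' : E → R} (h : X.up y t = X.up y' t') :
    y = y' ∧ t = t' := by
  have ht : t = t' := by
    ext i
    simpa using congrFun h (X.e (.inr i))
  subst ht
  refine ⟨?_, rfl⟩
  ext x
  have hx := congrFun h (X.e (.inl x))
  simp only [up_inl, add_left_inj] at hx
  rw [← X.sign_mul_sign_mul x (y x), hx, X.sign_mul_sign_mul]

theorem exists_up_eq (c : Q.V → R) : ∃ y t, X.up y t = c := by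
  refine ⟨fun x => ((X.s x : ℤ) : R) * (c (X.e (.inl x)) - ∑ i, (X.K i x : R) * c (X.e (.inr i))),
    fun i => c (X.e (.inr i)), ?_⟩
  refine funext (X.forall_node.mpr ⟨fun x => ?_, fun i => ?_⟩)
  · rw [up_inl, X.sign_mul_sign_mul]; ring
  · rw [up_inr]

theorem exists_down_eq (n : Q.V → R) : ∃ m k, X.down m k = n := by
  refine ⟨fun x => ((X.s x : ℤ) : R) * n (X.e (.inl x)),
    fun i => n (X.e (.inr i)) + ∑ x, (X.K i x : R) * n (X.e (.inl x)), ?_⟩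
  refine funext (X.forall_node.mpr ⟨fun x => ?_, fun i => ?_⟩)
  · rw [down_inl, X.sign_mul_sign_mul]
  · simp only [down_inr, X.sign_mul_sign_mul]; ring

theorem up_dotProduct_down (y : P.V → R) (t : E → R) (m : P.V → R) (k : E → R) :
    X.up y t ⬝ᵥ X.down m k = y ⬝ᵥ m + t ⬝ᵥ k := by
  simp only [dotProduct]
  rw [X.sum_node]
  simp only [up_inl, up_inr, down_inl, down_inr, mul_sub, add_mul, Finset.sum_add_distrib,
    Finset.sum_sub_distrib, Finset.sum_mul, Finset.mul_sum]
  have h1 : ∀ x, ((X.s x : ℤ) : R) * y x * (((X.s x : ℤ) : R) * m x) = y x * m x := fun x => by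
    rw [mul_mul_mul_comm, X.sign_mul_self, one_mul]
  have h2 : ∑ x, ∑ i, (X.K i x : R) * t i * (((X.s x : ℤ) : R) * m x) =
      ∑ i, ∑ x, t i * ((X.K i x : R) * (((X.s x : ℤ) : R) * m x)) := by
    rw [Finset.sum_comm]
    exact Finset.sum_congr rfl fun i _ => Finset.sum_congr rfl fun x _ => by ring
  simp only [h1, h2]
  ring

/-- The block congruence in usable form: `up` and `down` are the changes of basis in target and
source that turn the matrix of `Q` into `M ⊕ B`. -/
theorem mulVec_down (m : P.V → R) (k : E → R) :
    (Q.intMatrix.map ((↑) : ℤ → R)).mulVec (X.down m k) =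
      X.up ((P.intMatrix.map ((↑) : ℤ → R)).mulVec m) ((X.B.map ((↑) : ℤ → R)).mulVec k) := by
  have hm : ∀ x, ((P.intMatrix.map ((↑) : ℤ → R)).mulVec m) x =
      ∑ y, (P.intMatrix x y : R) * m y := fun x => rfl
  have hB : ∀ k' : E → R, ∀ i, ((X.B.map ((↑) : ℤ → R)).mulVec k') i = ∑ j, (X.B i j : R) * k' j :=
    fun k' x => rfl
  have hQ : ∀ q, ((Q.intMatrix.map ((↑) : ℤ → R)).mulVec (X.down m k)) q =
      ∑ q', (Q.intMatrix q q' : R) * X.down m k q' := fun x => rfl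
  set w : E → R := fun i => ∑ y, (X.K i y : R) * (((X.s y : ℤ) : R) * m y) with hw
  have hrow : ∀ i, ∑ y, (((X.B * X.K) i y : ℤ) : R) * (((X.s y : ℤ) : R) * m y) =
      ∑ j, (X.B i j : R) * w j := by
    intro i
    simp only [Matrix.mul_apply, Int.cast_sum, Int.cast_mul, Finset.sum_mul, hw, Finset.mul_sum]
    rw [Finset.sum_comm]
    exact Finset.sum_congr rfl fun i _ => Finset.sum_congr rfl fun x _ => by ring
  refine funext (X.forall_node.mpr ⟨fun x => ?_, fun i => ?_⟩)
  · rw [hQ, X.sum_node, up_inl, hm]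
    simp only [down_inl, down_inr, X.inl_inl, X.inl_inr, hB]
    have h1 : ∑ y, (((X.s x : ℤ) * (X.s y : ℤ) * P.intMatrix x y +
        (X.K.transpose * X.B * X.K) x y : ℤ) : R) * (((X.s y : ℤ) : R) * m y) =
        ((X.s x : ℤ) : R) * ∑ y, (P.intMatrix x y : R) * m y +
        ∑ i, (X.K i x : R) * ∑ j, (X.B i j : R) * w j := by
      simp only [← hrow, Finset.mul_sum]
      rw [Finset.sum_comm (γ := E), ← Finset.sum_add_distrib]
      refine Finset.sum_congr rfl fun y _ => ?_
      rw [Matrix.mul_assoc, Matrix.mul_apply]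
      push_cast
      simp only [Matrix.transpose_apply, add_mul, Finset.sum_mul]
      congr 1
      · linear_combination ((X.s x : ℤ) : R) * (P.intMatrix x y : R) * m y *
          X.sign_mul_self (R := R) y
      · exact Finset.sum_congr rfl fun i _ => by ring
    have h2 : ∑ j, (((X.K.transpose * X.B) x j : ℤ) : R) * (k j - w j) =
        ∑ i, (X.K i x : R) * ∑ j, (X.B i j : R) * (k j - w j) := by
      simp only [Matrix.mul_apply, Int.cast_sum, Int.cast_mul, Finset.sum_mul, Finset.mul_sum,
        Matrix.transpose_apply]
      rw [Finset.sum_comm]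
      exact Finset.sum_congr rfl fun i _ => Finset.sum_congr rfl fun x _ => by ring
    rw [h1, h2]
    simp only [mul_sub, Finset.sum_sub_distrib]
    ring
  · rw [hQ, X.sum_node, up_inr, hB]
    simp only [down_inl, down_inr, X.inr_inl, X.inr_inr]
    rw [hrow, ← Finset.sum_add_distrib]
    exact Finset.sum_congr rfl fun j _ => by simp only [hw]; ring

theorem up_add (y y' : P.V → R) (t t' : E → R) :
    X.up (y + y') (t + t') = X.up y t + X.up y' t' := by
  refine funext (X.forall_node.mpr ⟨fun x => ?_, fun i => ?_⟩)
  · simp only [Pi.add_apply, up_inl, mul_add, Finset.sum_add_distrib]; ring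
  · simp

theorem up_neg (y : P.V → R) (t : E → R) : X.up (-y) (-t) = -X.up y t := by
  refine funext (X.forall_node.mpr ⟨fun x => ?_, fun i => ?_⟩)
  · simp only [Pi.neg_apply, up_inl, mul_neg, Finset.sum_neg_distrib]; ring
  · simp

theorem up_sub (y y' : P.V → R) (t t' : E → R) :
    X.up (y - y') (t - t') = X.up y t - X.up y' t' := by
  rw [sub_eq_add_neg, sub_eq_add_neg, up_add, up_neg, ← sub_eq_add_neg]

theorem up_two_smul (y : P.V → R) (t : E → R) : X.up (2 • y) (2 • t) = 2 • X.up y t := by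
  rw [two_smul, two_smul, two_smul, up_add]

theorem down_add (y y' : P.V → R) (t t' : E → R) :
    X.down (y + y') (t + t') = X.down y t + X.down y' t' := by
  refine funext (X.forall_node.mpr ⟨fun x => ?_, fun i => ?_⟩)
  · simp only [Pi.add_apply, down_inl, mul_add]
  · simp only [Pi.add_apply, down_inr, mul_add, Finset.sum_add_distrib]; ring

theorem down_smul (c : R) (y : P.V → R) (t : E → R) :
    X.down (c • y) (c • t) = c • X.down y t := by
  refine funext (X.forall_node.mpr ⟨fun x => ?_, fun i => ?_⟩)
  · simp only [Pi.smul_apply, smul_eq_mul, down_inl]; ring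
  · simp only [Pi.smul_apply, smul_eq_mul, down_inr, mul_sub, Finset.mul_sum]
    congr 1
    exact Finset.sum_congr rfl fun x _ => by ring

end Ring

end Extension

end DefectPlumbing

theorem qPow_add (τ : ℍ) (r s : ℝ) : qPow τ (r + s) = qPow τ r * qPow τ s := by
  unfold qPow
  rw [← Complex.exp_add]
  congr 1
  push_cast
  ring

theorem tsum_equiv_prod {α β γ : Type*} (e : α × β ≃ γ) {f : γ → ℂ} (hf : Summable f) :
    ∑' c, f c = ∑' a, ∑' b, f (e (a, b)) := by
  rw [← e.tsum_eq]
  exact (e.summable_iff.mpr hf).tsum_prod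

theorem qPow_zero (τ : ℍ) : qPow τ 0 = 1 := by simp [qPow]

namespace DefectPlumbing

open scoped Classical in
theorem invForm_eq {P : DefectPlumbing.{u}} (hP : P.matrix.det ≠ 0) (m : P.V → ℝ) :
    P.invForm (P.matrix.mulVec m) = P.matrix.mulVec m ⬝ᵥ m := by
  unfold invForm
  rw [Matrix.mulVec_mulVec, Matrix.nonsing_inv_mul _ (isUnit_iff_ne_zero.mpr hP),
    Matrix.one_mulVec]

open scoped Classical in
theorem exists_mulVec_eq {P : DefectPlumbing.{u}} (hP : P.matrix.det ≠ 0) (y : P.V → ℝ) :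
    ∃ m, P.matrix.mulVec m = y :=
  ⟨P.matrix⁻¹.mulVec y, by
    rw [Matrix.mulVec_mulVec, Matrix.mul_nonsing_inv _ (isUnit_iff_ne_zero.mpr hP),
      Matrix.one_mulVec]⟩

namespace Extension

variable {P Q : DefectPlumbing.{u}} {E : Type} [Fintype E] [DecidableEq E] (X : Extension P Q E)

section Ring

variable {R : Type*} [CommRing R]

theorem mulVec_B_mulVec_B' (t : E → R) :
    (X.B.map ((↑) : ℤ → R)).mulVec ((X.B'.map ((↑) : ℤ → R)).mulVec t) = t := by
  have h : X.B.map ((↑) : ℤ → R) * X.B'.map ((↑) : ℤ → R) = 1 := by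
    calc _ = (X.B * X.B').map (Int.castRingHom R) :=
          (Matrix.map_mul (f := Int.castRingHom R)).symm
      _ = 1 := by rw [X.mul_inv]; simp
  rw [Matrix.mulVec_mulVec, h, Matrix.one_mulVec]

theorem down_injective {m m' : P.V → R} {k k' : E → R} (h : X.down m k = X.down m' k') :
    m = m' ∧ k = k' := by
  have hm : m = m' := by
    ext x
    have hx := congrFun h (X.e (.inl x))
    simp only [down_inl] at hx
    rw [← X.sign_mul_sign_mul x (m x), hx, X.sign_mul_sign_mul]
  subst hm
  refine ⟨rfl, ?_⟩
  ext i
  simpa using congrFun h (X.e (.inr i))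

/-- `down` as a linear equivalence. -/
def downEquiv : ((P.V → R) × (E → R)) ≃ₗ[R] (Q.V → R) :=
  LinearEquiv.ofBijective
    { toFun := fun p => X.down p.1 p.2
      map_add' := fun p p' => X.down_add _ _ _ _
      map_smul' := fun c p => X.down_smul _ _ _ }
    ⟨fun p p' h => Prod.ext_iff.mpr (X.down_injective h), fun n => by
      obtain ⟨m, k, h⟩ := X.exists_down_eq n
      exact ⟨(m, k), h⟩⟩

end Ring

/-! #### Quadratic forms and prefactors -/

theorem cast_up (y : P.V → ℤ) (t : E → ℤ) :
    (fun q => ((X.up y t q : ℤ) : ℝ)) = X.up (fun x => (y x : ℝ)) (fun i => (t i : ℝ)) := by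
  refine funext (X.forall_node.mpr ⟨fun x => ?_, fun i => ?_⟩)
  · simp
  · simp

-- With `y = Mm` and `t = Bk`, the preimage of `up y t` is `down m k`, and the pairing of `up` with
-- `down` splits into old and new parts.
open scoped Classical in
theorem invForm_up (hP : P.matrix.det ≠ 0) (hQ : Q.matrix.det ≠ 0) (y : P.V → ℝ) (t : E → ℝ) :
    Q.invForm (X.up y t) = P.invForm y + t ⬝ᵥ (X.B'.map ((↑) : ℤ → ℝ)).mulVec t := by
  obtain ⟨m, rfl⟩ := exists_mulVec_eq hP y
  have h : Q.matrix.mulVec (X.down m ((X.B'.map ((↑) : ℤ → ℝ)).mulVec t)) =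
      X.up (P.matrix.mulVec m) t := by
    have h0 := X.mulVec_down m ((X.B'.map ((↑) : ℤ → ℝ)).mulVec t)
    rw [X.mulVec_B_mulVec_B'] at h0
    exact h0
  rw [invForm_eq hP, ← h, invForm_eq hQ, h, up_dotProduct_down]

/-- A diagonalization of the added block with `p` positive and `n` negative entries. -/
structure BlockSignature (p n : ℕ) : Prop where
  exists_diag : ∃ (d : E → ℝ) (C C' : (E → ℝ) →ₗ[ℝ] (E → ℝ)), (∀ t, C (C' t) = t) ∧
    (∀ t, t ⬝ᵥ (X.B.map ((↑) : ℤ → ℝ)).mulVec t = ∑ i, d i * C t i ^ 2) ∧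
    Nat.card {i // 0 < d i} = p ∧ Nat.card {i // d i < 0} = n

/-- In the coordinates given by `down` the form of `Q` is the orthogonal sum of that of `P` and the
block, so diagonalizations can be put side by side. -/
theorem numPos_numNeg {p n : ℕ} (h : X.BlockSignature p n) :
    Q.numPos = P.numPos + p ∧ Q.numNeg = P.numNeg + n := by
  classical
  obtain ⟨d, C, C', hC, hd, hp, hn⟩ := h.exists_diag
  obtain ⟨L, L', hL, hLd⟩ := P.exists_diagonalization
  let a := LinearEquiv.sumArrowLequivProdArrow P.V E ℝ ℝ
  have key := Q.numPos_numNeg_eq (Sum.elim P.eig d)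
    (a.symm.toLinearMap ∘ₗ (L.prodMap C) ∘ₗ X.downEquiv.symm.toLinearMap)
    (X.downEquiv.toLinearMap ∘ₗ (L'.prodMap C') ∘ₗ a.toLinearMap)
    (fun x => by
      simp only [LinearMap.comp_apply, LinearEquiv.coe_coe, LinearEquiv.symm_apply_apply,
        LinearMap.prodMap_apply, hL, hC]
      exact a.symm_apply_apply x)
    (fun x => by
      obtain ⟨m, k, rfl⟩ := X.exists_down_eq x
      have h1 : X.downEquiv.symm (X.down m k) = (m, k) :=
        (LinearEquiv.symm_apply_eq _).mpr rfl
      have h2 : Q.matrix.mulVec (X.down m k) =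
        X.up (P.matrix.mulVec m) ((X.B.map ((↑) : ℤ → ℝ)).mulVec k) := X.mulVec_down m k
      simp only [LinearMap.comp_apply, LinearEquiv.coe_coe, h1, LinearMap.prodMap_apply,
        Fintype.sum_sum_type, Sum.elim_inl, Sum.elim_inr, h2, a,
        LinearEquiv.sumArrowLequivProdArrow_symm_apply_inl,
        LinearEquiv.sumArrowLequivProdArrow_symm_apply_inr]
      rw [← hLd, ← hd, dotProduct_comm, up_dotProduct_down, dotProduct_comm m, dotProduct_comm k])
  have self := P.numPos_numNeg_eq P.eig L L' hL hLd
  rw [key.1, key.2, self.1, self.2, ← hp, ← hn]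
  simp only [Finset.card_filter, Fintype.sum_sum_type, Sum.elim_inl, Sum.elim_inr,
    Nat.card_eq_fintype_card, Fintype.card_subtype]
  exact ⟨rfl, rfl⟩

theorem prefactor_eq {p n : ℕ} (h : X.BlockSignature p n) (τ : ℍ) :
    Q.prefactor τ = P.prefactor τ * ((-1) ^ p * qPow τ ((3 * ((p : ℝ) - n) -
      ((∑ q, (Q.weight q : ℝ)) - ∑ x, (P.weight x : ℝ))) / 4)) := by
  obtain ⟨h1, h2⟩ := X.numPos_numNeg h
  unfold prefactor sig
  rw [h1, h2, pow_add, mul_mul_mul_comm, ← qPow_add]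
  congr 2
  push_cast
  ring

/-! #### Labels -/

theorem even_up {y : P.V → ℤ} {t : E → ℤ} (hy : ∀ x, Even (y x - P.deg x - P.nu x))
    (ht : ∀ i, Even (t i - X.t₀ i)) (q : Q.V) : Even (X.up y t q - Q.deg q - Q.nu q) := by
  revert q
  refine X.forall_node.mpr ⟨fun x => ?_, fun i => ?_⟩
  · have h1 := X.even_inl x
    have h2 : Even (∑ i, X.K i x * (t i - X.t₀ i)) :=
      Finset.even_sum _ fun i _ => (ht i).mul_left _
    -- Changing the sign of an entry preserves its parity.
    have h3 : Even (((X.s x : ℤ) - 1) * y x) := by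
      rcases Int.units_eq_one_or (X.s x) with h | h <;> rw [h]
      · simp
      · exact ⟨-y x, by simp; ring⟩
    have e : X.up y t (X.e (.inl x)) - Q.deg (X.e (.inl x)) - Q.nu (X.e (.inl x)) =
        (((X.s x : ℤ) - 1) * y x + (y x - P.deg x - P.nu x) +
          ∑ i, X.K i x * (t i - X.t₀ i)) -
        ((Q.deg (X.e (.inl x)) : ℤ) - P.deg x - ∑ i, X.K i x * X.t₀ i) := by
      rw [up_inl, X.nu_inl]
      simp only [mul_sub, Finset.sum_sub_distrib, Int.cast_id]
      ring
    rw [e]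
    exact ((h3.add (hy x)).add h2).sub h1
  · rw [up_inr, X.nu_inr]
    have e : t i - Q.deg (X.e (.inr i)) - ((0 : ℕ) : ℤ) =
        (t i - X.t₀ i) - ((Q.deg (X.e (.inr i)) : ℤ) - X.t₀ i) := by push_cast; ring
    rw [e]
    exact (ht i).sub (X.even_inr i)

theorem even_of_even_up {y : P.V → ℤ} {t : E → ℤ}
    (h : ∀ q, Even (X.up y t q - Q.deg q - Q.nu q)) :
    (∀ x, Even (y x - P.deg x - P.nu x)) ∧ ∀ i, Even (t i - X.t₀ i) := by
  obtain ⟨hl, hr⟩ := X.forall_node.mp h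
  have ht : ∀ i, Even (t i - X.t₀ i) := fun i => by
    have h1 := (hr i).add (X.even_inr i)
    rw [up_inr, X.nu_inr] at h1
    have e : t i - X.t₀ i = t i - Q.deg (X.e (.inr i)) - ((0 : ℕ) : ℤ) +
        ((Q.deg (X.e (.inr i)) : ℤ) - X.t₀ i) := by push_cast; ring
    rwa [e]
  refine ⟨fun x => ?_, ht⟩
  have h1 := X.even_inl x
  have h2 : Even (∑ i, X.K i x * (t i - X.t₀ i)) :=
    Finset.even_sum _ fun i _ => (ht i).mul_left _
  have h3 : Even (((X.s x : ℤ) - 1) * y x) := by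
    rcases Int.units_eq_one_or (X.s x) with h | h <;> rw [h]
    · simp
    · exact ⟨-y x, by simp; ring⟩
  have e : y x - P.deg x - P.nu x =
      (X.up y t (X.e (.inl x)) - Q.deg (X.e (.inl x)) - Q.nu (X.e (.inl x))) -
      ((X.s x : ℤ) - 1) * y x - ∑ i, X.K i x * (t i - X.t₀ i) +
      ((Q.deg (X.e (.inl x)) : ℤ) - P.deg x - ∑ i, X.K i x * X.t₀ i) := by
    rw [up_inl, X.nu_inl]
    simp only [mul_sub, Finset.sum_sub_distrib, Int.cast_id]
    ring
  rw [e]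
  exact (((hl x).sub h3).sub h2).add h1

theorem intMatrix_mulVec_down (m : P.V → ℤ) (k : E → ℤ) :
    Q.intMatrix.mulVec (X.down m k) = X.up (P.intMatrix.mulVec m) (X.B.mulVec k) := by
  exact X.mulVec_down (R := ℤ) m k

theorem B_mulVec_B'_mulVec (t : E → ℤ) : X.B.mulVec (X.B'.mulVec t) = t := by
  rw [Matrix.mulVec_mulVec, X.mul_inv, Matrix.one_mulVec]

theorem even_shifted {P : DefectPlumbing.{u}} (b : P.Label) (x : P.V) :
    Even (b.shifted x - P.deg x - P.nu x) := by
  have h := b.2 x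
  unfold Label.shifted
  convert h using 1
  ring

/-- The map on labels. -/
def mapLabel (b : P.Label) : Q.Label :=
  ⟨fun q => X.up b.shifted X.t₀ q - Q.nu q, fun q => by
    have h := X.even_up (even_shifted b) (t := X.t₀) (fun i => by simp) q
    convert h using 1
    ring⟩

theorem shifted_mapLabel (b : P.Label) : (X.mapLabel b).shifted = X.up b.shifted X.t₀ := by
  ext q
  simp [mapLabel, Label.shifted]

theorem label_sub {P : DefectPlumbing.{u}} (b c : P.Label) :
    b.1 - c.1 = b.shifted - c.shifted := by
  ext x
  simp [Label.shifted]

theorem mapLabel_rel_iff (b c : P.Label) :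
    P.labelSetoid.r b c ↔ Q.labelSetoid.r (X.mapLabel b) (X.mapLabel c) := by
  change (∃ n, b.1 - c.1 = _) ↔ ∃ n, (X.mapLabel b).1 - (X.mapLabel c).1 = _
  simp only [label_sub, shifted_mapLabel, ← up_sub, sub_self]
  constructor
  · rintro ⟨n, hn⟩
    refine ⟨X.down n 0, ?_⟩
    rw [intMatrix_mulVec_down, ← up_two_smul, ← hn]
    simp
  · rintro ⟨n, hn⟩
    obtain ⟨m, k, rfl⟩ := X.exists_down_eq n
    rw [intMatrix_mulVec_down, ← up_two_smul] at hn
    exact ⟨m, (X.up_injective hn).1⟩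

/-- The induced map on `Spin^c` structures. -/
def spinMap : P.SpinC → Q.SpinC :=
  Quotient.map X.mapLabel fun b c h => (X.mapLabel_rel_iff b c).mp h

theorem spinMap_bijective : Function.Bijective X.spinMap := by
  constructor
  · intro s s' h
    obtain ⟨b, rfl⟩ := Quotient.exists_rep s
    obtain ⟨c, rfl⟩ := Quotient.exists_rep s'
    exact Quotient.sound ((X.mapLabel_rel_iff b c).mpr (Quotient.exact h))
  · intro s
    obtain ⟨c, rfl⟩ := Quotient.exists_rep s
    obtain ⟨y, t, hyt⟩ := X.exists_up_eq (R := ℤ) c.shifted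
    have hpar := X.even_of_even_up (y := y) (t := t) (by rw [hyt]; exact even_shifted c)
    choose j hj using hpar.2
    let b : P.Label := ⟨fun x => y x - P.nu x, fun x => by
      have h := hpar.1 x
      convert h using 1
      ring⟩
    have hb : b.shifted = y := by
      ext x
      simp [b, Label.shifted]
    refine ⟨b.toSpinC, Quotient.sound ?_⟩
    change ∃ n, (X.mapLabel b).1 - c.1 = _
    -- The entries of `c` on the new nodes are `t = t₀ + 2j`; since `B` is unimodular, the
    -- discrepancy `-2j` is `2B(-B'j)` and disappears modulo the lattice.
    refine ⟨X.down 0 (X.B'.mulVec (-j)), ?_⟩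
    rw [label_sub, shifted_mapLabel, hb, ← hyt, ← up_sub, intMatrix_mulVec_down, ← up_two_smul,
      B_mulVec_B'_mulVec]
    congr 1
    · simp
    · ext i
      have := hj i
      simp only [Pi.sub_apply, Pi.smul_apply, Pi.neg_apply, two_nsmul]
      omega

/-- The induced bijection of `Spin^c` structures. -/
def spinEquiv : P.SpinC ≃ Q.SpinC := Equiv.ofBijective X.spinMap X.spinMap_bijective

/-! #### The theta series -/

theorem mem_thetaIndex_up {β : P.V → ℤ} {ℓ : Q.V → ℤ} :
    ℓ ∈ Q.thetaIndex (X.up β X.t₀) ↔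
      ∃ y ∈ P.thetaIndex β, ∃ t : E → ℤ, (∀ i, Even (t i - X.t₀ i)) ∧ X.up y t = ℓ := by
  constructor
  · rintro (⟨n, rfl⟩ | ⟨n, rfl⟩) <;> obtain ⟨m, k, rfl⟩ := X.exists_down_eq n
    · refine ⟨_, Or.inl ⟨m, rfl⟩, 2 • X.B.mulVec k + X.t₀, fun i => ?_, ?_⟩
      · simp
      · rw [intMatrix_mulVec_down, up_add, up_two_smul]
    -- Since `-t₀ ≡ t₀` mod 2, both halves of the index set `± β` meet the same vectors `t`, so the
    -- product decomposition survives their union.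
    · refine ⟨_, Or.inr ⟨m, rfl⟩, 2 • X.B.mulVec k - X.t₀, fun i => ?_, ?_⟩
      · refine ⟨X.B.mulVec k i - X.t₀ i, ?_⟩
        simp only [Pi.sub_apply, Pi.add_apply, two_nsmul]
        ring
      · rw [intMatrix_mulVec_down, up_sub, up_two_smul]
  · rintro ⟨y, hy, t, ht, rfl⟩
    choose j hj using ht
    rcases hy with ⟨m, rfl⟩ | ⟨m, rfl⟩
    · refine Or.inl ⟨X.down m (X.B'.mulVec j), ?_⟩
      rw [intMatrix_mulVec_down, B_mulVec_B'_mulVec, ← up_two_smul, ← up_add]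
      congr 1
      ext i
      have := hj i
      simp only [Pi.add_apply, two_nsmul]
      omega
    -- On this half `t = t₀ + 2j` must be written as `2(j + t₀) - t₀`.
    · refine Or.inr ⟨X.down m (X.B'.mulVec (j + X.t₀)), ?_⟩
      rw [intMatrix_mulVec_down, B_mulVec_B'_mulVec, ← up_two_smul, ← up_sub]
      congr 1
      ext i
      have := hj i
      simp only [Pi.sub_apply, Pi.add_apply, two_nsmul]
      omega

theorem even_of_mem_thetaIndex {P : DefectPlumbing.{u}} {b : P.Label} {y : P.V → ℤ}
    (hy : y ∈ P.thetaIndex b.shifted) (x : P.V) : Even (y x - P.deg x - P.nu x) := by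
  have h := even_shifted b x
  rcases hy with ⟨m, rfl⟩ | ⟨m, rfl⟩
  · have e : (2 • P.intMatrix.mulVec m + b.shifted) x - P.deg x - P.nu x =
        2 * P.intMatrix.mulVec m x + (b.shifted x - P.deg x - P.nu x) := by
      simp only [Pi.add_apply, two_nsmul]
      ring
    rw [e]
    exact (even_two_mul _).add h
  · have e : (2 • P.intMatrix.mulVec m - b.shifted) x - P.deg x - P.nu x =
        2 * (P.intMatrix.mulVec m x - P.deg x - P.nu x) - (b.shifted x - P.deg x - P.nu x) := by
      simp only [Pi.sub_apply, Pi.add_apply, two_nsmul]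
      ring
    rw [e]
    exact (even_two_mul _).sub h

/-- The admissible labels on the new nodes. -/
abbrev NewLabel : Type := {t : E → ℤ // ∀ i, Even (t i - X.t₀ i)}

/-- The index set of the theta series of `Q` is a product. -/
def thetaEquiv (β : P.V → ℤ) :
    P.thetaIndex β × X.NewLabel ≃ Q.thetaIndex (X.up β X.t₀) :=
  Equiv.ofBijective
    (fun p => ⟨X.up p.1.1 p.2.1, X.mem_thetaIndex_up.mpr ⟨p.1.1, p.1.2, p.2.1, p.2.2, rfl⟩⟩)
    ⟨fun p p' h => by
      obtain ⟨h1, h2⟩ := X.up_injective (Subtype.ext_iff.mp h)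
      exact Prod.ext (Subtype.ext h1) (Subtype.ext h2), fun ℓ => by
      obtain ⟨y, hy, t, ht, h⟩ := X.mem_thetaIndex_up.mp ℓ.2
      exact ⟨(⟨y, hy⟩, ⟨t, ht⟩), Subtype.ext h⟩⟩

theorem thetaEquiv_apply (β : P.V → ℤ) (p : P.thetaIndex β × X.NewLabel) :
    (X.thetaEquiv β p : Q.V → ℤ) = X.up p.1.1 p.2.1 := rfl

/-- The product of Laurent coefficients attached to a lattice vector. -/
def _root_.DefectPlumbing.coeffProd (P : DefectPlumbing.{u}) (ℓ : P.V → ℤ) : ℂ :=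
  ∏ v, pvCoeff (2 - (P.deg v : ℤ)) (P.nu v) (ℓ v)

/-- Summation over the labels of the new nodes reproduces the integrand of `P` up to a factor which
is compensated by the prefactors. -/
def LocalIdentity (τ : ℍ) (c : ℂ) : Prop :=
  ∀ y : P.V → ℤ, (∀ x, Even (y x - P.deg x - P.nu x)) →
    ∑' t : X.NewLabel, qPow τ (-((fun i => (t.1 i : ℝ)) ⬝ᵥ
      (X.B'.map ((↑) : ℤ → ℝ)).mulVec fun i => (t.1 i : ℝ)) / 4) * Q.coeffProd (X.up y t.1) =
    c * P.coeffProd y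

theorem zhatLabel_mapLabel (hP : P.IsWeaklyNegativeTree) (hQ : Q.IsWeaklyNegativeTree) (τ : ℍ)
    {c : ℂ} (hc : X.LocalIdentity τ c) (hpre : Q.prefactor τ * c = P.prefactor τ) (b : P.Label) :
    Q.zhatLabel (X.mapLabel b) τ = P.zhatLabel b τ := by
  unfold zhatLabel
  rw [← hpre, mul_assoc, X.shifted_mapLabel]
  congr 1
  -- Absolute convergence for `Q` permits summing over the new labels first, with the old label
  -- fixed.
  have hs : Summable fun ℓ : Q.thetaIndex (X.up b.shifted X.t₀) => Q.zhatTerm τ ℓ :=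
    (hQ.summable_zhatTerm τ).subtype _
  rw [tsum_equiv_prod (X.thetaEquiv b.shifted) hs, ← tsum_mul_left]
  refine tsum_congr fun y => ?_
  have h1 : ∀ t : X.NewLabel, Q.zhatTerm τ (X.thetaEquiv b.shifted (y, t) : Q.V → ℤ) =
      qPow τ (-(P.invForm fun v => (y.1 v : ℝ)) / 4) * (qPow τ (-((fun i => (t.1 i : ℝ)) ⬝ᵥ
        (X.B'.map ((↑) : ℤ → ℝ)).mulVec fun i => (t.1 i : ℝ)) / 4) *
        Q.coeffProd (X.up y.1 t.1)) := by
    intro t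
    rw [zhatTerm_eq, thetaEquiv_apply, cast_up, X.invForm_up hP.det_ne_zero hQ.det_ne_zero,
      ← mul_assoc, ← qPow_add]
    unfold coeffProd
    congr 2
    ring
  simp only [h1]
  rw [tsum_mul_left, hc y.1 (even_of_mem_thetaIndex y.2), zhatTerm_eq]
  unfold coeffProd
  ring

/-- Invariance of `Ẑ` and the bijection of `Spin^c` structures for an extension. -/
theorem exists_spinEquiv (hP : P.IsWeaklyNegativeTree) (hQ : Q.IsWeaklyNegativeTree)
    (h : ∀ τ, ∃ c, X.LocalIdentity τ c ∧ Q.prefactor τ * c = P.prefactor τ)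
    {T : (P.V → ℤ) → (Q.V → ℤ)} (hT : ∀ β, T β = X.up β X.t₀) :
    ∃ φ : P.SpinC ≃ Q.SpinC,
      (∀ b : P.Label, ∃ b' : Q.Label, b'.shifted = T b.shifted ∧ φ b.toSpinC = b'.toSpinC) ∧
      ∀ (s : P.SpinC) (τ : ℍ), Q.zhat (φ s) τ = P.zhat s τ := by
  refine ⟨X.spinEquiv, fun b => ⟨X.mapLabel b, ?_, rfl⟩, fun s τ => ?_⟩
  · rw [hT, shifted_mapLabel]
  · obtain ⟨b, rfl⟩ := Quotient.exists_rep s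
    obtain ⟨c, hc, hpre⟩ := h τ
    exact X.zhatLabel_mapLabel hP hQ τ hc hpre b

end Extension

end DefectPlumbing

/-! ### Further properties of Laurent coefficients -/

/-- Flipping the label of a node of degree `d` costs `(-1)^(2-d) = (-1)^d`, which turns sign changes
on branches into a count over edges. -/
theorem pvCoeff_sign_mul (s : ℤˣ) (d ν : ℕ) (ℓ : ℤ) :
    pvCoeff (2 - (d : ℤ)) ν ((s : ℤ) * ℓ) =
      (((s : ℤ) : ℂ)) ^ d * pvCoeff (2 - (d : ℤ)) ν ℓ := by
  rcases Int.units_eq_one_or s with rfl | rfl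
  · simp
  · have h : (-1 : ℂ) ^ (2 - (d : ℤ)) = (-1) ^ d := by
      rw [zpow_sub₀ (by norm_num)]
      rcases Nat.even_or_odd d with hd | hd <;> simp [hd.neg_one_pow]
    have e : ((-1 : ℤˣ) : ℤ) * ℓ = -ℓ := by simp
    rw [e, pvCoeff_neg, h]
    simp

theorem pvCoeff_natCast_eq_zero_of_odd (n ν : ℕ) (ℓ : ℤ) (h : ¬ Even (ℓ - n - ν)) :
    pvCoeff n ν ℓ = 0 := by
  rw [Int.not_even_iff_odd] at h
  induction n generalizing ℓ with
  | zero =>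
    obtain ⟨j, hj⟩ := h
    rw [Nat.cast_zero, pvCoeff_zero_eq_sum]
    refine Finset.sum_eq_zero fun k _ => if_neg ?_
    push_cast at hj
    omega
  | succ n ih =>
    obtain ⟨j, hj⟩ := h
    push_cast at hj ⊢
    rw [pvCoeff_add_one, ih, ih, sub_zero]
    · exact ⟨j, by omega⟩
    · exact ⟨j + 1, by omega⟩

/-- The coefficients of a product in which one factor is a Laurent polynomial. -/
theorem hasSum_pvCoeff_mul_zero_left (n : ℤ) (ν : ℕ) (y : ℤ) :
    HasSum (fun p : ℤ => pvCoeff 0 0 p * pvCoeff n ν (y + p)) (pvCoeff n ν y) := by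
  have h := hasSum_single (f := fun p : ℤ => pvCoeff 0 0 p * pvCoeff n ν (y + p)) 0 fun p hp => by
    rw [pvCoeff_zero_zero, if_neg hp, zero_mul]
  simpa [pvCoeff_zero_zero] using h

theorem hasSum_pvCoeff_mul_one_left (n : ℤ) (ν : ℕ) (y : ℤ) :
    HasSum (fun p : ℤ => pvCoeff 1 0 p * pvCoeff n ν (y + p)) (-pvCoeff (n + 1) ν y) := by
  have h1 := hasSum_single (f := fun p : ℤ => (if p = -1 then 1 else 0) * pvCoeff n ν (y + p)) (-1)
    fun p hp => by rw [if_neg hp, zero_mul]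
  have h2 := hasSum_single (f := fun p : ℤ => (if p = 1 then 1 else 0) * pvCoeff n ν (y + p)) 1
    fun p hp => by rw [if_neg hp, zero_mul]
  simp only [if_true, one_mul] at h1 h2
  rw [pvCoeff_add_one, neg_sub, funext fun p : ℤ => show pvCoeff 1 0 p * pvCoeff n ν (y + p) =
    (if p = -1 then 1 else 0) * pvCoeff n ν (y + p) -
      (if p = 1 then 1 else 0) * pvCoeff n ν (y + p) by rw [pvCoeff_one_zero, sub_mul]]
  exact h1.sub h2

/-- Each monomial of the character selects one `p`, at the negative of a shifted `y`; reflecting it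
back produces `(-1)^a`. -/
theorem hasSum_pvCoeff_mul_zero_right (a : ℤ) (ν : ℕ) (y : ℤ) :
    HasSum (fun p : ℤ => pvCoeff a 0 p * pvCoeff 0 ν (y + p)) ((-1) ^ a * pvCoeff a ν y) := by
  have h1 : ∀ k ∈ Finset.range (ν + 1), HasSum
      (fun p : ℤ => pvCoeff a 0 p * (if y + p + (ν - 2 * k) = 0 then 1 else 0))
      ((-1) ^ a * pvCoeff a 0 (y + (ν - 2 * k))) := by
    intro k _
    have h := hasSum_single
      (f := fun p : ℤ => pvCoeff a 0 p * (if y + p + ((ν : ℤ) - 2 * k) = 0 then 1 else 0))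
      (-(y + (ν - 2 * k))) fun p hp => by
        rw [if_neg (by intro h0; apply hp; linarith), mul_zero]
    convert h using 1
    rw [if_pos (by ring), mul_one, pvCoeff_neg]
  convert hasSum_sum h1 using 1
  · ext p
    rw [pvCoeff_zero_eq_sum, Finset.mul_sum]
  · rw [pvCoeff_eq_sum, Finset.mul_sum]

theorem hasSum_pvCoeff_mul_one_right (a : ℤ) (ν : ℕ) (y : ℤ) :
    HasSum (fun p : ℤ => pvCoeff a 0 p * pvCoeff 1 ν (y + p)) ((-1) ^ a * pvCoeff (a + 1) ν y) := by
  rw [pvCoeff_add_one, mul_sub, funext fun p : ℤ =>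
    show pvCoeff a 0 p * pvCoeff 1 ν (y + p) = pvCoeff a 0 p * pvCoeff 0 ν (y + 1 + p) -
      pvCoeff a 0 p * pvCoeff 0 ν (y - 1 + p) by
        have h := pvCoeff_add_one 0 ν (y + p)
        rw [zero_add] at h
        rw [h, mul_sub, add_right_comm, add_sub_right_comm]]
  exact (hasSum_pvCoeff_mul_zero_right a ν (y + 1)).sub (hasSum_pvCoeff_mul_zero_right a ν (y - 1))

/-! ### Signs on graphs -/

/-- A product of vertex signs raised to the degrees is a product over edges. -/
theorem prod_sign_pow_degree {V : Type*} [Fintype V] [DecidableEq V] (G : SimpleGraph V)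
    [DecidableRel G.Adj] (s : V → ℤˣ) (F : Finset (Sym2 V)) (c : ℤˣ) (hF : F ⊆ G.edgeFinset)
    (hs : ∀ x y, G.Adj x y → s x * s y = if s(x, y) ∈ F then c else 1) :
    ∏ x, s x ^ G.degree x = c ^ F.card := by
  -- The product over darts is grouped by source on one side and by underlying edge on the other; an
  -- edge `xy` collects `s x * s y`.
  have h1 : ∏ d : G.Dart, s d.fst = ∏ x, s x ^ G.degree x := by
    rw [← Finset.prod_fiberwise (s := Finset.univ) (g := fun d : G.Dart => d.fst)]
    refine Finset.prod_congr rfl fun x _ => ?_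
    rw [← G.dart_fst_fiber_card_eq_degree, ← Finset.prod_const]
    refine Finset.prod_congr rfl fun d hd => ?_
    rw [(Finset.mem_filter.mp hd).2]
  have h2 : ∏ d : G.Dart, s d.fst = ∏ e ∈ G.edgeFinset, if e ∈ F then c else 1 := by
    rw [← Finset.prod_fiberwise_of_maps_to (s := Finset.univ) (t := G.edgeFinset)
      (g := fun d : G.Dart => d.edge) fun d _ => by simp]
    refine Finset.prod_congr rfl fun e he => ?_
    induction e with
    | h x y =>
      have hxy : G.Adj x y := by simpa using he
      have hf := SimpleGraph.Dart.edge_fiber (G := G) ⟨(x, y), hxy⟩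
      have hne : (⟨(x, y), hxy⟩ : G.Dart) ≠ (⟨(x, y), hxy⟩ : G.Dart).symm :=
        (SimpleGraph.Dart.symm_ne _).symm
      change ∏ d ∈ Finset.univ.filter (fun d : G.Dart => d.edge =
        (⟨(x, y), hxy⟩ : G.Dart).edge), s d.fst = _
      rw [hf, Finset.prod_pair hne]
      exact hs x y hxy
  rw [← h1, h2, Finset.prod_ite, Finset.prod_const, Finset.prod_const_one, mul_one,
    Finset.filter_mem_eq_inter, Finset.inter_eq_right.mpr hF]

/-! ### Branches of a tree, degree counts and unit blocks -/

namespace DefectPlumbing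

variable {P Q : DefectPlumbing.{u}}

theorem mem_sideOf_self (u v : P.V) : v ∈ P.sideOf u v := SimpleGraph.Reachable.refl _

/-- Every edge of a tree is a bridge. This is what makes the signs on the two sides of an edge well
defined. -/
theorem notMem_sideOf (hP : P.graph.IsTree) {u v : P.V} (h : P.graph.Adj u v) :
    u ∉ P.sideOf u v := fun hu =>
  SimpleGraph.isBridge_iff.mp (SimpleGraph.isAcyclic_iff_forall_adj_isBridge.mp hP.isAcyclic h)
    (SimpleGraph.Reachable.symm hu)

theorem mem_sideOf_iff {u v x y : P.V} (h : P.graph.Adj x y) (hne : s(x, y) ≠ s(u, v)) :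
    x ∈ P.sideOf u v ↔ y ∈ P.sideOf u v := by
  have hadj : (P.graph.deleteEdges {s(u, v)}).Adj x y :=
    SimpleGraph.deleteEdges_adj.mpr ⟨h, by simpa using hne⟩
  exact ⟨fun hx => SimpleGraph.Reachable.trans hx hadj.reachable,
    fun hy => SimpleGraph.Reachable.trans hy hadj.symm.reachable⟩

open scoped Classical in
theorem deg_eq_sum (v : P.V) : (P.deg v : ℤ) = ∑ w, if P.graph.Adj v w then 1 else 0 := by
  unfold deg
  rw [← SimpleGraph.card_neighborFinset_eq_degree, SimpleGraph.neighborFinset_eq_filter,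
    Finset.card_filter]
  push_cast
  rfl

open scoped Classical in
theorem deg_eq_sum_add_sum {E : Type*} [Fintype E] (e : P.V ⊕ E ≃ Q.V) (q : Q.V) :
    (Q.deg q : ℤ) = ∑ x, (if Q.graph.Adj q (e (.inl x)) then 1 else 0) +
      ∑ i, if Q.graph.Adj q (e (.inr i)) then 1 else 0 := by
  rw [deg_eq_sum, ← e.sum_comp, Fintype.sum_sum_type]

open scoped Classical in
theorem intMatrix_apply (v w : P.V) : P.intMatrix v w =
    if v = w then P.weight v else if P.graph.Adj v w then 1 else 0 := rfl

open scoped Classical in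
theorem prod_sign_pow_deg (s : P.V → ℤˣ) (F : Finset (Sym2 P.V)) (c : ℤˣ)
    (hF : F ⊆ P.graph.edgeFinset)
    (hs : ∀ x y, P.graph.Adj x y → s x * s y = if s(x, y) ∈ F then c else 1) :
    ∏ x, (((s x : ℤˣ) : ℤ) : ℂ) ^ P.deg x = (((c ^ F.card : ℤˣ) : ℤ) : ℂ) := by
  have h := prod_sign_pow_degree P.graph s F c hF hs
  rw [← h]
  push_cast
  rfl

namespace Extension

variable {E : Type} [Fintype E] [DecidableEq E] (X : Extension P Q E)

theorem coeffProd_up (y : P.V → ℤ) (t : E → ℤ) : Q.coeffProd (X.up y t) =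
    (∏ x, pvCoeff (2 - (Q.deg (X.e (.inl x)) : ℤ)) (P.nu x)
      ((X.s x : ℤ) * y x + ∑ i, X.K i x * t i)) *
    ∏ i, pvCoeff (2 - (Q.deg (X.e (.inr i)) : ℤ)) 0 (t i) := by
  unfold coeffProd
  rw [X.prod_node]
  simp only [up_inl, up_inr, X.nu_inl, X.nu_inr, Int.cast_id]

theorem sum_weight : ∑ q, (Q.weight q : ℝ) =
    ∑ x, (Q.weight (X.e (.inl x)) : ℝ) + ∑ i, (Q.weight (X.e (.inr i)) : ℝ) := X.sum_node _

theorem blockSignature_unit {X : Extension P Q Unit} {ε : ℤˣ} (h : X.B () () = ε) :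
    X.BlockSignature (if ε = 1 then 1 else 0) (if ε = 1 then 0 else 1) := by
  have h0 : Fintype.card {_i : Unit // (1 : ℝ) < 0} = 0 :=
    Fintype.card_eq_zero_iff.mpr ⟨fun i => absurd i.2 (by norm_num)⟩
  refine ⟨fun _ => ((ε : ℤ) : ℝ), LinearMap.id, LinearMap.id, fun t => rfl, fun t => ?_, ?_, ?_⟩
  · simp [dotProduct, Matrix.mulVec, h]
    ring
  · rcases Int.units_eq_one_or ε with rfl | rfl <;> simp [show ¬ ((-1 : ℤˣ) = 1) by decide, h0]
  · rcases Int.units_eq_one_or ε with rfl | rfl <;> simp [show ¬ ((-1 : ℤˣ) = 1) by decide, h0]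

theorem prefactor_unit {X : Extension P Q Unit} {ε : ℤˣ} (h : X.B () () = ε) {a : ℝ}
    (ha : ∑ q, (Q.weight q : ℝ) = ∑ x, (P.weight x : ℝ) + a) (τ : ℍ) :
    Q.prefactor τ = P.prefactor τ * (-((ε : ℤ) : ℂ) * qPow τ ((3 * ((ε : ℤ) : ℝ) - a) / 4)) := by
  rw [X.prefactor_eq (blockSignature_unit h), ha]
  congr 2
  · rcases Int.units_eq_one_or ε with rfl | rfl <;> simp [show ¬ ((-1 : ℤˣ) = 1) by decide]
  · congr 1
    rcases Int.units_eq_one_or ε with rfl | rfl <;> simp [show ¬ ((-1 : ℤˣ) = 1) by decide]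

end Extension

end DefectPlumbing

namespace DefectPlumbing

/-! ### Blow-up of an edge -/

theorem eq_or_eq_iff_of_ne {V : Type*} {u v : V} (h : u ≠ v) (x : V) [DecidableEq V] {R : Type*}
    [AddMonoid R] (a : R) : (if x = u ∨ x = v then a else 0) =
      (if x = u then a else 0) + (if x = v then a else 0) := by
  by_cases hxu : x = u
  · subst hxu; simp [h]
  · simp [hxu]

section Edge

variable (P : DefectPlumbing.{u}) (u v : P.V) (ε : ℤˣ)

open scoped Classical in
/-- The signs on the two sides of an edge. -/
def edgeSign (x : P.V) : ℤˣ := if x ∈ P.sideOf u v then -ε else 1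

variable {u v}

theorem edgeSign_mul (hP : P.graph.IsTree) (h : P.graph.Adj u v) {x y : P.V}
    (hxy : P.graph.Adj x y) [Decidable (s(x, y) = s(u, v))] :
    P.edgeSign u v ε x * P.edgeSign u v ε y = if s(x, y) = s(u, v) then -ε else 1 := by
  have h1 := P.mem_sideOf_self u v
  have h2 := notMem_sideOf hP h
  split_ifs with he
  · rcases Sym2.eq_iff.mp he with ⟨rfl, rfl⟩ | ⟨rfl, rfl⟩ <;> simp [edgeSign, h1, h2]
  · have h3 := mem_sideOf_iff hxy he
    unfold edgeSign
    by_cases hx : x ∈ P.sideOf u v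
    · simp [hx, h3.mp hx, Int.units_mul_self]
    · simp [hx, show y ∉ P.sideOf u v from fun hy => hx (h3.mpr hy)]

theorem Sym2_eq_of_mem {α : Type*} {u v x y : α} (hne : x ≠ y) (hx : x = u ∨ x = v)
    (hy : y = u ∨ y = v) : s(x, y) = s(u, v) := by
  rcases hx with rfl | rfl <;> rcases hy with rfl | rfl
  · exact absurd rfl hne
  · rfl
  · exact Sym2.eq_swap
  · exact absurd rfl hne


variable (u v)

open scoped Classical in
/-- `Q` is the blow-up of the edge `uv` of `P`, with nodes named by `e`. -/
structure IsEdgeBlowUp (Q : DefectPlumbing.{u}) (e : P.V ⊕ Unit ≃ Q.V) : Prop where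
  adj_inl_inl : ∀ x y, Q.graph.Adj (e (.inl x)) (e (.inl y)) ↔
    P.graph.Adj x y ∧ s(x, y) ≠ s(u, v)
  adj_inl_inr : ∀ x i, Q.graph.Adj (e (.inl x)) (e (.inr i)) ↔ x = u ∨ x = v
  weight_inl : ∀ x, Q.weight (e (.inl x)) =
    P.weight x + ((if x = u then (ε : ℤ) else 0) + if x = v then (ε : ℤ) else 0)
  weight_inr : ∀ i, Q.weight (e (.inr i)) = ε
  nu_inl : ∀ x, Q.nu (e (.inl x)) = P.nu x
  nu_inr : ∀ i, Q.nu (e (.inr i)) = 0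

open scoped Classical in
theorem isEdgeBlowUp (h : P.graph.Adj u v) : P.IsEdgeBlowUp u v ε (P.edgeBlowUp u v ε)
    (Equiv.optionEquivSumPUnit P.V).symm where
  adj_inl_inl x y := by
    change ((some x : Option P.V) ≠ some y ∧ ((P.graph.Adj x y ∧ s(x, y) ≠ s(u, v)) ∨
      (P.graph.Adj y x ∧ s(y, x) ≠ s(u, v)))) ↔ _
    rw [P.graph.adj_comm y x, Sym2.eq_swap (a := y), or_self]
    exact ⟨fun h => h.2, fun h => ⟨fun e => h.1.ne (Option.some_injective _ e), h⟩⟩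
  adj_inl_inr x i := by
    change ((some x : Option P.V) ≠ none ∧ (False ∨ (x = u ∨ x = v))) ↔ _
    simp
  weight_inl x := by
    rw [← eq_or_eq_iff_of_ne h.ne]
    rfl
  weight_inr i := rfl
  nu_inl x := rfl
  nu_inr i := rfl

namespace IsEdgeBlowUp

variable {P u v ε} {Q : DefectPlumbing.{u}} {e : P.V ⊕ Unit ≃ Q.V}

theorem deg_inl (H : P.IsEdgeBlowUp u v ε Q e) (h : P.graph.Adj u v) (x : P.V) :
    Q.deg (e (.inl x)) = P.deg x := by
  classical
  have h1 := deg_eq_sum_add_sum e (e (.inl x))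
  have h2 : ∀ y, (if P.graph.Adj x y ∧ s(x, y) ≠ s(u, v) then (1 : ℤ) else 0) =
      (if P.graph.Adj x y then 1 else 0) - (if y = v then (if x = u then 1 else 0) else 0) -
        (if y = u then (if x = v then 1 else 0) else 0) := by
    intro y
    by_cases he : s(x, y) = s(u, v)
    · rcases Sym2.eq_iff.mp he with ⟨rfl, rfl⟩ | ⟨rfl, rfl⟩
      · simp [h, h.ne']
      · simp [h.symm, h.ne, h.ne']
    · have n1 : y = v → x ≠ u := by rintro rfl rfl; exact he rfl
      have n2 : y = u → x ≠ v := by rintro rfl rfl; exact he Sym2.eq_swap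
      by_cases hyv : y = v <;> by_cases hyu : y = u <;> simp_all
  simp only [H.adj_inl_inl, H.adj_inl_inr, h2, Finset.sum_sub_distrib, Finset.sum_ite_eq',
    Finset.mem_univ, if_true, ← deg_eq_sum, eq_or_eq_iff_of_ne h.ne, Finset.univ_unique,
    Finset.sum_singleton] at h1
  have : (Q.deg (e (.inl x)) : ℤ) = P.deg x := by linarith
  exact_mod_cast this

theorem deg_inr (H : P.IsEdgeBlowUp u v ε Q e) (h : P.graph.Adj u v) (i : Unit) :
    Q.deg (e (.inr i)) = 2 := by
  classical
  have h1 := deg_eq_sum_add_sum e (e (.inr i))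
  simp only [Q.graph.adj_comm (e (.inr i)) (e (.inl _)), H.adj_inl_inr,
    eq_or_eq_iff_of_ne h.ne, Finset.univ_unique, Finset.sum_singleton, SimpleGraph.irrefl, if_false,
    Finset.sum_add_distrib, Finset.sum_ite_eq', Finset.mem_univ, if_true] at h1
  norm_num at h1
  exact_mod_cast h1

open scoped Classical in
/-- Blowing up an edge is an extension by `(ε)`. -/
def extension (H : P.IsEdgeBlowUp u v ε Q e) (hP : P.graph.IsTree) (h : P.graph.Adj u v) :
    Extension P Q Unit where
  e := e
  -- As `B⁻¹ = (ε)`, the row `K` is `ε` times the adjacency of the new node. Then `KᵀBK` adds `ε` to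
  -- the weights of `u` and `v` and also to the entry `uv`, where it cancels `s u * s v = -ε`: the
  -- edge is removed.
  s := P.edgeSign u v ε
  K := Matrix.of fun _ x => if x = u ∨ x = v then (ε : ℤ) else 0
  B := Matrix.of fun _ _ => (ε : ℤ)
  B' := Matrix.of fun _ _ => (ε : ℤ)
  t₀ := 0
  mul_inv := by
    ext i j
    simp [Matrix.mul_apply, ← Units.val_mul, Int.units_mul_self]
  inl_inl x y := by
    have hε : (ε : ℤ) * ε = 1 := by rw [← Units.val_mul, Int.units_mul_self]; rfl
    rw [intMatrix_apply, intMatrix_apply]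
    simp only [H.adj_inl_inl, Matrix.mul_apply, Finset.univ_unique, Finset.sum_singleton,
      Matrix.of_apply, Matrix.transpose_apply, EmbeddingLike.apply_eq_iff_eq, Sum.inl.injEq]
    by_cases hxy : x = y
    · subst hxy
      rw [if_pos rfl, if_pos rfl, ← Units.val_mul, Int.units_mul_self, H.weight_inl,
        ← eq_or_eq_iff_of_ne h.ne]
      split_ifs
      · rw [hε]; simp
      · simp
    · rw [if_neg hxy, if_neg hxy]
      by_cases hadj : P.graph.Adj x y
      · have hs := P.edgeSign_mul ε hP h hadj
        rw [← Units.val_mul, hs]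
        by_cases he : s(x, y) = s(u, v)
        · rcases Sym2.eq_iff.mp he with ⟨rfl, rfl⟩ | ⟨rfl, rfl⟩ <;> simp [hadj, hε]
        · have : ¬ ((x = u ∨ x = v) ∧ (y = u ∨ y = v)) := fun h' =>
            he (Sym2_eq_of_mem hxy h'.1 h'.2)
          by_cases hx : x = u ∨ x = v
          · have hy : ¬ (y = u ∨ y = v) := fun hy => this ⟨hx, hy⟩
            rw [if_pos ⟨hadj, he⟩, if_neg he, if_pos hadj, if_neg hy]
            simp
          · rw [if_pos ⟨hadj, he⟩, if_neg he, if_pos hadj, if_neg hx]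
            simp
      · have : ¬ ((x = u ∨ x = v) ∧ (y = u ∨ y = v)) := by
          rintro ⟨rfl | rfl, rfl | rfl⟩
          · exact hxy rfl
          · exact hadj h
          · exact hadj h.symm
          · exact hxy rfl
        rw [if_neg hadj, if_neg (fun h' => hadj h'.1)]
        by_cases hx : x = u ∨ x = v
        · have hy : ¬ (y = u ∨ y = v) := fun hy => this ⟨hx, hy⟩
          rw [if_neg hy]
          simp
        · rw [if_neg hx]
          simp
  inl_inr x i := by
    have hε : (ε : ℤ) * ε = 1 := by rw [← Units.val_mul, Int.units_mul_self]; rfl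
    rw [intMatrix_apply]
    simp only [H.adj_inl_inr, Matrix.mul_apply, Finset.univ_unique, Finset.sum_singleton,
      Matrix.of_apply, Matrix.transpose_apply, EmbeddingLike.apply_eq_iff_eq, reduceCtorEq,
      if_false]
    split_ifs
    · rw [hε]
    · simp
  inr_inl i x := by
    have hε : (ε : ℤ) * ε = 1 := by rw [← Units.val_mul, Int.units_mul_self]; rfl
    rw [intMatrix_apply]
    simp only [Q.graph.adj_comm (e (.inr i)) (e (.inl _)), H.adj_inl_inr, Matrix.mul_apply,
      Finset.univ_unique, Finset.sum_singleton, Matrix.of_apply, EmbeddingLike.apply_eq_iff_eq,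
      reduceCtorEq, if_false]
    split_ifs
    · rw [hε]
    · simp
  inr_inr i j := by
    rw [intMatrix_apply, if_pos rfl, H.weight_inr]
    rfl
  nu_inl := H.nu_inl
  nu_inr := H.nu_inr
  even_inl x := by
    rw [H.deg_inl h]
    simp
  even_inr i := by
    rw [H.deg_inr h]
    simp

-- The new node has degree 2 and kernel 1, so only `t = 0` contributes. Of the signs there remains
-- one factor `-ε`, from the single edge `uv` where they jump.
open scoped Classical in
theorem localIdentity (H : P.IsEdgeBlowUp u v ε Q e) (hP : P.graph.IsTree) (h : P.graph.Adj u v)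
    (τ : ℍ) : (H.extension hP h).LocalIdentity τ (-((ε : ℤ) : ℂ)) := by
  intro y _
  set X := H.extension hP h with hX
  have d1 : ∀ x, Q.deg (X.e (.inl x)) = P.deg x := H.deg_inl h
  have d2 : ∀ i, Q.deg (X.e (.inr i)) = 2 := H.deg_inr h
  have hs : ∏ x, (((X.s x : ℤˣ) : ℤ) : ℂ) ^ P.deg x = -((ε : ℤ) : ℂ) := by
    have := prod_sign_pow_deg (P.edgeSign u v ε) {s(u, v)} (-ε) (by simpa using h)
      fun x y hxy => by simpa using P.edgeSign_mul ε hP h hxy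
    rw [Finset.card_singleton, pow_one] at this
    refine Eq.trans this ?_
    simp
  rw [tsum_eq_single (⟨0, fun i => by simp [hX, extension]⟩ : X.NewLabel)]
  · rw [X.coeffProd_up]
    simp only [d1, d2, Pi.zero_apply, mul_zero, Finset.sum_const_zero, add_zero, pvCoeff_sign_mul,
      Finset.prod_mul_distrib, hs]
    simp [qPow_zero, pvCoeff_zero_zero, dotProduct, coeffProd]
  · intro t ht
    have : t.1 () ≠ 0 := fun h0 => ht (Subtype.ext (funext fun _ => h0))
    rw [X.coeffProd_up]
    simp [d2, pvCoeff_zero_zero, this]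

open scoped Classical in
theorem prefactor_mul (H : P.IsEdgeBlowUp u v ε Q e) (hP : P.graph.IsTree) (h : P.graph.Adj u v)
    (τ : ℍ) : Q.prefactor τ * (-((ε : ℤ) : ℂ)) = P.prefactor τ := by
  -- The weights of `u`, `v` and the new node contribute `3ε`, which cancels the change `3ε` of
  -- `3σ`.
  have hw : ∑ q, (Q.weight q : ℝ) = ∑ x, (P.weight x : ℝ) + 3 * ((ε : ℤ) : ℝ) := by
    rw [(H.extension hP h).sum_weight]
    have h1 : ∀ x, Q.weight ((H.extension hP h).e (.inl x)) = _ := H.weight_inl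
    have h2 : ∀ i, Q.weight ((H.extension hP h).e (.inr i)) = _ := H.weight_inr
    simp only [h1, h2, Int.cast_add, Int.cast_ite, Int.cast_zero, Finset.sum_add_distrib,
      Finset.sum_ite_eq', Finset.mem_univ, if_true, Finset.univ_unique, Finset.sum_singleton]
    ring
  rw [Extension.prefactor_unit (X := H.extension hP h) (ε := ε) rfl hw, sub_self, zero_div,
    qPow_zero]
  rcases Int.units_eq_one_or ε with rfl | rfl <;> simp

theorem exists_spinEquiv (H : P.IsEdgeBlowUp u v ε Q e) (h : P.graph.Adj u v)
    (hP : P.IsWeaklyNegativeTree) (hQ : Q.IsWeaklyNegativeTree) {T : (P.V → ℤ) → (Q.V → ℤ)}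
    (hT : ∀ β x, T β (e (.inl x)) = (P.edgeSign u v ε x : ℤ) * β x)
    (hT' : ∀ β i, T β (e (.inr i)) = 0) :
    ∃ φ : P.SpinC ≃ Q.SpinC,
      (∀ b : P.Label, ∃ b' : Q.Label, b'.shifted = T b.shifted ∧ φ b.toSpinC = b'.toSpinC) ∧
      ∀ (s : P.SpinC) (τ : ℍ), Q.zhat (φ s) τ = P.zhat s τ := by
  refine (H.extension hP.isTree h).exists_spinEquiv hP hQ
    (fun τ => ⟨_, H.localIdentity hP.isTree h τ, H.prefactor_mul hP.isTree h τ⟩) fun β => ?_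
  refine funext ((H.extension hP.isTree h).forall_node.mpr ⟨fun x => ?_, fun i => ?_⟩)
  · rw [Extension.up_inl]
    simpa [extension] using hT β x
  · rw [Extension.up_inr]
    exact hT' β i

end IsEdgeBlowUp

open scoped Classical in
theorem edgeBlowUp_exists_spinEquiv (h : P.graph.Adj u v) (hP : P.IsWeaklyNegativeTree)
    (hQ : (P.edgeBlowUp u v ε).IsWeaklyNegativeTree) :
    ∃ φ : P.SpinC ≃ (P.edgeBlowUp u v ε).SpinC,
      (∀ b : P.Label, ∃ b' : (P.edgeBlowUp u v ε).Label,
        b'.shifted = P.edgeTransport u v ε b.shifted ∧ φ b.toSpinC = b'.toSpinC) ∧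
      ∀ (s : P.SpinC) (τ : ℍ), (P.edgeBlowUp u v ε).zhat (φ s) τ = P.zhat s τ := by
  refine (P.isEdgeBlowUp u v ε h).exists_spinEquiv h hP hQ (fun β x => ?_) fun β i => rfl
  change (if x ∈ P.sideOf u v then -(ε : ℤ) * β x else β x) = _
  unfold edgeSign
  split_ifs <;> simp

end Edge

end DefectPlumbing

namespace DefectPlumbing

/-! ### Blow-up at a node -/

section Leaf

variable (P : DefectPlumbing.{u}) (v : P.V) (ε : ℤˣ)

open scoped Classical in
/-- `Q` is the blow-up of `P` at the node `v`, with nodes named by `e`. -/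
structure IsLeafBlowUp (Q : DefectPlumbing.{u}) (e : P.V ⊕ Unit ≃ Q.V) : Prop where
  adj_inl_inl : ∀ x y, Q.graph.Adj (e (.inl x)) (e (.inl y)) ↔ P.graph.Adj x y
  adj_inl_inr : ∀ x i, Q.graph.Adj (e (.inl x)) (e (.inr i)) ↔ x = v
  weight_inl : ∀ x, Q.weight (e (.inl x)) = P.weight x + if x = v then (ε : ℤ) else 0
  weight_inr : ∀ i, Q.weight (e (.inr i)) = ε
  nu_inl : ∀ x, Q.nu (e (.inl x)) = P.nu x
  nu_inr : ∀ i, Q.nu (e (.inr i)) = 0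

theorem isLeafBlowUp : P.IsLeafBlowUp v ε (P.leafBlowUp v ε)
    (Equiv.optionEquivSumPUnit P.V).symm where
  adj_inl_inl x y := by
    change ((some x : Option P.V) ≠ some y ∧ (P.graph.Adj x y ∨ P.graph.Adj y x)) ↔ _
    rw [P.graph.adj_comm y x, or_self]
    exact ⟨fun h => h.2, fun h => ⟨fun e => h.ne (Option.some_injective _ e), h⟩⟩
  adj_inl_inr x i := by
    change ((some x : Option P.V) ≠ none ∧ (False ∨ x = v)) ↔ _
    simp
  weight_inl x := rfl
  weight_inr i := rfl
  nu_inl x := rfl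
  nu_inr i := rfl

namespace IsLeafBlowUp

variable {P v ε} {Q : DefectPlumbing.{u}} {e : P.V ⊕ Unit ≃ Q.V}

open scoped Classical in
theorem deg_inl (H : P.IsLeafBlowUp v ε Q e) (x : P.V) :
    Q.deg (e (.inl x)) = P.deg x + if x = v then 1 else 0 := by
  have h1 := deg_eq_sum_add_sum e (e (.inl x))
  simp only [H.adj_inl_inl, H.adj_inl_inr, ← deg_eq_sum, Finset.univ_unique,
    Finset.sum_singleton] at h1
  exact_mod_cast h1

theorem deg_inr (H : P.IsLeafBlowUp v ε Q e) (i : Unit) : Q.deg (e (.inr i)) = 1 := by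
  classical
  have h1 := deg_eq_sum_add_sum e (e (.inr i))
  simp only [Q.graph.adj_comm (e (.inr i)) (e (.inl _)), H.adj_inl_inr, Finset.univ_unique,
    Finset.sum_singleton, SimpleGraph.irrefl, if_false, Finset.sum_ite_eq', Finset.mem_univ,
    if_true] at h1
  norm_num at h1
  exact_mod_cast h1

open scoped Classical in
/-- Blowing up at a node is an extension by `(ε)`. -/
def extension (H : P.IsLeafBlowUp v ε Q e) : Extension P Q Unit where
  e := e
  s := fun _ => 1
  K := Matrix.of fun _ x => if x = v then (ε : ℤ) else 0
  B := Matrix.of fun _ _ => (ε : ℤ)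
  B' := Matrix.of fun _ _ => (ε : ℤ)
  -- With `K = ε` at `v`, this gives the shift `ε * ε = 1` of the label there.
  t₀ := fun _ => (ε : ℤ)
  mul_inv := by
    ext i j
    simp [Matrix.mul_apply, ← Units.val_mul, Int.units_mul_self]
  inl_inl x y := by
    have hε : (ε : ℤ) * ε = 1 := by rw [← Units.val_mul, Int.units_mul_self]; rfl
    rw [intMatrix_apply, intMatrix_apply]
    simp only [H.adj_inl_inl, H.weight_inl, Matrix.mul_apply, Finset.univ_unique,
      Finset.sum_singleton, Matrix.of_apply, Matrix.transpose_apply,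
      EmbeddingLike.apply_eq_iff_eq, Sum.inl.injEq]
    by_cases hxy : x = y
    · subst hxy
      by_cases hx : x = v <;> simp [hx, hε]
    · by_cases hx : x = v
      · subst hx
        have hy : ¬ y = x := fun h => hxy h.symm
        simp [hxy, hy]
      · simp [hxy, hx]
  inl_inr x i := by
    have hε : (ε : ℤ) * ε = 1 := by rw [← Units.val_mul, Int.units_mul_self]; rfl
    rw [intMatrix_apply]
    simp only [H.adj_inl_inr, Matrix.mul_apply, Finset.univ_unique, Finset.sum_singleton,
      Matrix.of_apply, Matrix.transpose_apply, EmbeddingLike.apply_eq_iff_eq, reduceCtorEq,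
      if_false]
    split_ifs
    · rw [hε]
    · simp
  inr_inl i x := by
    have hε : (ε : ℤ) * ε = 1 := by rw [← Units.val_mul, Int.units_mul_self]; rfl
    rw [intMatrix_apply]
    simp only [Q.graph.adj_comm (e (.inr i)) (e (.inl _)), H.adj_inl_inr, Matrix.mul_apply,
      Finset.univ_unique, Finset.sum_singleton, Matrix.of_apply, EmbeddingLike.apply_eq_iff_eq,
      reduceCtorEq, if_false]
    split_ifs
    · rw [hε]
    · simp
  inr_inr i j := by
    rw [intMatrix_apply, if_pos rfl, H.weight_inr]
    rfl
  nu_inl := H.nu_inl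
  nu_inr := H.nu_inr
  even_inl x := by
    have hε : (ε : ℤ) * ε = 1 := by rw [← Units.val_mul, Int.units_mul_self]; rfl
    rw [H.deg_inl]
    by_cases hx : x = v <;> simp [hx, hε]
  even_inr i := by
    rw [H.deg_inr]
    rcases Int.units_eq_one_or ε with rfl | rfl <;> decide

open scoped Classical in
theorem localIdentity (H : P.IsLeafBlowUp v ε Q e) (τ : ℍ) :
    H.extension.LocalIdentity τ (-((ε : ℤ) : ℂ) * qPow τ (-((ε : ℤ) : ℝ) / 4)) := by
  intro y _
  set X := H.extension with hX
  have d1 : ∀ x, Q.deg (X.e (.inl x)) = P.deg x + if x = v then 1 else 0 := H.deg_inl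
  have d2 : ∀ i, Q.deg (X.e (.inr i)) = 1 := H.deg_inr
  have hodd : ∀ j : ℤ, Odd j → ∀ i, Even ((fun _ : Unit => j) i - X.t₀ i) := fun j hj i =>
    hj.sub_odd (by
      change Odd (ε : ℤ)
      rcases Int.units_eq_one_or ε with rfl | rfl <;> decide)
  -- A leaf has kernel `z - z⁻¹`, so only `t = ±1` contribute, with opposite coefficients. Both have
  -- the same factor `q^{-ε/4}`, and their difference is the recursion `pvCoeff_add_one` at `v`, up
  -- to the sign `-ε`.
  let tp : X.NewLabel := ⟨fun _ => 1, hodd 1 (by decide)⟩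
  let tm : X.NewLabel := ⟨fun _ => -1, hodd (-1) (by decide)⟩
  have hne : tp ≠ tm := fun h => by
    have h1 := congrFun (Subtype.ext_iff.mp h) ()
    simp only [tp, tm] at h1
    omega
  have hs : ∀ x, X.s x = 1 := fun _ => rfl
  have hK : ∀ i x, X.K i x = if x = v then (ε : ℤ) else 0 := fun _ _ => rfl
  have hB : ∀ t : Unit → ℤ, (fun i => (t i : ℝ)) ⬝ᵥ
      (X.B'.map ((↑) : ℤ → ℝ)).mulVec (fun i => (t i : ℝ)) = ((ε : ℤ) : ℝ) * (t () : ℝ) ^ 2 := by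
    intro t
    simp [hX, extension, dotProduct, Matrix.mulVec]
    ring
  set C : ℂ := ∏ x ∈ Finset.univ.erase v, pvCoeff (2 - (P.deg x : ℤ)) (P.nu x) (y x) with hC
  have hprod : ∀ t : Unit → ℤ, Q.coeffProd (X.up y t) =
      pvCoeff (1 - (P.deg v : ℤ)) (P.nu v) (y v + (ε : ℤ) * t ()) * C * pvCoeff 1 0 (t ()) := by
    intro t
    have herase : ∏ x ∈ Finset.univ.erase v, pvCoeff (2 - (Q.deg (X.e (.inl x)) : ℤ)) (P.nu x)
        ((X.s x : ℤ) * y x + ∑ i, X.K i x * t i) = C := by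
      refine Finset.prod_congr rfl fun x hx => ?_
      have hx' : x ≠ v := Finset.ne_of_mem_erase hx
      rw [d1, hs, Fintype.sum_unique, hK, if_neg hx', if_neg hx', add_zero, zero_mul, add_zero,
        Units.val_one, one_mul]
    rw [X.coeffProd_up, ← Finset.mul_prod_erase Finset.univ _ (Finset.mem_univ v), herase, d1, hs,
      Fintype.sum_unique, hK, if_pos rfl, if_pos rfl, Fintype.prod_unique, d2, Units.val_one,
      one_mul, show (2 - ((P.deg v + 1 : ℕ) : ℤ)) = 1 - (P.deg v : ℤ) by push_cast; ring]
    rfl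
  have hP : P.coeffProd y = (pvCoeff (1 - (P.deg v : ℤ)) (P.nu v) (y v + 1) -
      pvCoeff (1 - (P.deg v : ℤ)) (P.nu v) (y v - 1)) * C := by
    unfold coeffProd
    rw [← Finset.mul_prod_erase _ _ (Finset.mem_univ v), ← pvCoeff_add_one,
      show 1 - (P.deg v : ℤ) + 1 = 2 - P.deg v by ring]
  rw [tsum_eq_sum (s := {tp, tm})]
  · rw [Finset.sum_pair hne]
    simp only [hB, hprod, hP, tp, tm, pvCoeff_one_zero]
    rcases Int.units_eq_one_or ε with rfl | rfl
    · norm_num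
      simp only [← sub_eq_add_neg]
      ring
    · norm_num
      simp only [← sub_eq_add_neg]
      ring
  · intro t ht
    have h1 : t.1 () ≠ 1 := fun h0 => ht (by
      have : t = tp := Subtype.ext (funext fun _ => h0)
      simp [this])
    have h2 : t.1 () ≠ -1 := fun h0 => ht (by
      have : t = tm := Subtype.ext (funext fun _ => h0)
      simp [this])
    rw [X.coeffProd_up]
    simp [d2, pvCoeff_one_zero, h1, h2]

open scoped Classical in
theorem prefactor_mul (H : P.IsLeafBlowUp v ε Q e) (τ : ℍ) :
    Q.prefactor τ * (-((ε : ℤ) : ℂ) * qPow τ (-((ε : ℤ) : ℝ) / 4)) = P.prefactor τ := by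
  have hw : ∑ q, (Q.weight q : ℝ) = ∑ x, (P.weight x : ℝ) + 2 * ((ε : ℤ) : ℝ) := by
    rw [H.extension.sum_weight]
    have h1 : ∀ x, Q.weight (H.extension.e (.inl x)) = _ := H.weight_inl
    have h2 : ∀ i, Q.weight (H.extension.e (.inr i)) = _ := H.weight_inr
    simp only [h1, h2, Int.cast_add, Int.cast_ite, Int.cast_zero, Finset.sum_add_distrib,
      Finset.sum_ite_eq', Finset.mem_univ, if_true, Finset.univ_unique, Finset.sum_singleton]
    ring
  rw [Extension.prefactor_unit (X := H.extension) (ε := ε) rfl hw, mul_assoc, mul_mul_mul_comm,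
    ← qPow_add, show (3 * ((ε : ℤ) : ℝ) - 2 * ((ε : ℤ) : ℝ)) / 4 + -((ε : ℤ) : ℝ) / 4 = 0 by ring,
    qPow_zero]
  rcases Int.units_eq_one_or ε with rfl | rfl <;> simp

end IsLeafBlowUp

open scoped Classical in
theorem leafBlowUp_exists_spinEquiv (hP : P.IsWeaklyNegativeTree)
    (hQ : (P.leafBlowUp v ε).IsWeaklyNegativeTree) :
    ∃ φ : P.SpinC ≃ (P.leafBlowUp v ε).SpinC,
      (∀ b : P.Label, ∃ b' : (P.leafBlowUp v ε).Label,
        b'.shifted = P.leafTransport v ε b.shifted ∧ φ b.toSpinC = b'.toSpinC) ∧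
      ∀ (s : P.SpinC) (τ : ℍ), (P.leafBlowUp v ε).zhat (φ s) τ = P.zhat s τ := by
  have H := P.isLeafBlowUp v ε
  refine H.extension.exists_spinEquiv hP hQ
    (fun τ => ⟨_, H.localIdentity τ, H.prefactor_mul τ⟩) fun β => ?_
  have hε : (ε : ℤ) * ε = 1 := by rw [← Units.val_mul, Int.units_mul_self]; rfl
  refine funext (H.extension.forall_node.mpr ⟨fun x => ?_, fun i => ?_⟩)
  · rw [Extension.up_inl]
    change (if x = v then β x + 1 else β x) = _
    by_cases hx : x = v <;> simp [IsLeafBlowUp.extension, hx, hε]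
  · rw [Extension.up_inr]
    rfl

end Leaf

end DefectPlumbing

/-! ### Convolution of coefficients within a parity class -/

/-- The convolution of two coefficient functions, one of which is finitely supported. -/
theorem hasSum_pvCoeff_mul {a n : ℤ} (h : a = 0 ∨ a = 1 ∨ n = 0 ∨ n = 1) (ν : ℕ) (y : ℤ) :
    HasSum (fun p : ℤ => pvCoeff a 0 p * pvCoeff n ν (y + p))
      ((-1) ^ a * pvCoeff (a + n) ν y) := by
  rcases h with rfl | rfl | rfl | rfl
  · simpa using hasSum_pvCoeff_mul_zero_left n ν y
  · simpa [add_comm] using hasSum_pvCoeff_mul_one_left n ν y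
  · simpa using hasSum_pvCoeff_mul_zero_right a ν y
  · exact hasSum_pvCoeff_mul_one_right a ν y

/-- The Laurent polynomial factor has coefficients in one parity class only; if that factor is the
second, the parity of `y` transfers the constraint to `p`. -/
theorem even_of_pvCoeff_mul_ne_zero {a n : ℤ} (h : a = 0 ∨ a = 1 ∨ n = 0 ∨ n = 1) {ν : ℕ} {y p : ℤ}
    (hy : Even (y - a - n - ν)) (hp : pvCoeff a 0 p * pvCoeff n ν (y + p) ≠ 0) :
    Even (p - a) := by
  have hl : ∀ m : ℕ, a = m → Even (p - a) := fun m hm => by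
    by_contra hodd
    refine left_ne_zero_of_mul hp ?_
    subst hm
    exact pvCoeff_natCast_eq_zero_of_odd m 0 p (by simpa using hodd)
  have hr : ∀ m : ℕ, n = m → Even (p - a) := fun m hm => by
    have h1 : Even (y + p - n - ν) := by
      by_contra hodd
      refine right_ne_zero_of_mul hp ?_
      subst hm
      exact pvCoeff_natCast_eq_zero_of_odd m ν (y + p) hodd
    have h2 := h1.sub hy
    have e : p - a = y + p - n - ν - (y - a - n - ν) - 2 * a := by ring
    rw [e]
    exact h2.sub (even_two_mul a)
  rcases h with h | h | h | h
  · exact hl 0 h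
  · exact hl 1 h
  · exact hr 0 h
  · exact hr 1 h

theorem tsum_pvCoeff_mul {a n k : ℤ} (h : a = 0 ∨ a = 1 ∨ n = 0 ∨ n = 1) {ν : ℕ} {y : ℤ}
    (hy : Even (y - a - n - ν)) (hk : Even (k - a)) :
    ∑' p : {p : ℤ // Even (p - k)}, pvCoeff a 0 p * pvCoeff n ν (y + p) =
      (-1) ^ a * pvCoeff (a + n) ν y := by
  rw [← (hasSum_pvCoeff_mul h ν y).tsum_eq]
  refine Subtype.val_injective.tsum_eq (f := fun p : ℤ => pvCoeff a 0 p * pvCoeff n ν (y + p))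
    fun p hp => ?_
  have h1 := (even_of_pvCoeff_mul_ne_zero h hy hp).sub hk
  rw [sub_sub_sub_cancel_right] at h1
  exact ⟨⟨p, h1⟩, rfl⟩

namespace DefectPlumbing

/-! ### Zero-chain extrusion -/

section Chain

variable (P : DefectPlumbing.{u}) (w : P.V) (N : Set P.V) (c : ℤ)

open scoped Classical in
/-- The sign change on the branches at `w` through `N`. -/
def chainSign (x : P.V) : ℤˣ := if ∃ y ∈ N, x ∈ P.sideOf w y then -1 else 1

variable {P w N}

theorem chainSign_self (hP : P.graph.IsTree) (hN : N ⊆ P.graph.neighborSet w) :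
    P.chainSign w N w = 1 := by
  unfold chainSign
  rw [if_neg]
  rintro ⟨y, hy, hw⟩
  exact notMem_sideOf hP (hN hy) hw

theorem chainSign_of_mem {z : P.V} (hz : z ∈ N) : P.chainSign w N z = -1 := by
  unfold chainSign
  rw [if_pos ⟨z, hz, mem_sideOf_self w z⟩]

theorem chainSign_mul_of_mem (hP : P.graph.IsTree) (hN : N ⊆ P.graph.neighborSet w) {x y : P.V}
    (h : (x = w ∧ y ∈ N) ∨ (y = w ∧ x ∈ N)) : P.chainSign w N x * P.chainSign w N y = -1 := by
  rcases h with ⟨rfl, h⟩ | ⟨rfl, h⟩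
  · rw [chainSign_self hP hN, chainSign_of_mem h, one_mul]
  · rw [chainSign_self hP hN, chainSign_of_mem h, mul_one]

theorem chainSign_mul_of_notMem {x y : P.V} (hxy : P.graph.Adj x y)
    (h : ¬ ((x = w ∧ y ∈ N) ∨ (y = w ∧ x ∈ N))) :
    P.chainSign w N x * P.chainSign w N y = 1 := by
  have key : (∃ z ∈ N, x ∈ P.sideOf w z) ↔ ∃ z ∈ N, y ∈ P.sideOf w z := by
    refine exists_congr fun z => and_congr_right fun hz => mem_sideOf_iff hxy fun he => h ?_
    rcases Sym2.eq_iff.mp he with ⟨rfl, rfl⟩ | ⟨rfl, rfl⟩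
    · exact Or.inl ⟨rfl, hz⟩
    · exact Or.inr ⟨rfl, hz⟩
  unfold chainSign
  by_cases hx : ∃ z ∈ N, x ∈ P.sideOf w z
  · rw [if_pos hx, if_pos (key.mp hx), Int.units_mul_self]
  · rw [if_neg hx, if_neg fun hy => hx (key.mpr hy), Int.units_mul_self]

/-- The sign jumps exactly across the `|N|` edges from `w` to `N`. -/
theorem prod_chainSign (hP : P.graph.IsTree) (hN : N ⊆ P.graph.neighborSet w) :
    ∏ x, (((P.chainSign w N x : ℤˣ) : ℤ) : ℂ) ^ P.deg x = (-1) ^ N.ncard := by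
  classical
  have hmem : ∀ x y, s(x, y) ∈ N.toFinset.image (fun z => s(w, z)) ↔
      (x = w ∧ y ∈ N) ∨ (y = w ∧ x ∈ N) := by
    intro x y
    simp only [Finset.mem_image, Set.mem_toFinset]
    constructor
    · rintro ⟨z, hz, he⟩
      rcases Sym2.eq_iff.mp he with ⟨rfl, rfl⟩ | ⟨rfl, rfl⟩
      · exact Or.inl ⟨rfl, hz⟩
      · exact Or.inr ⟨rfl, hz⟩
    · rintro (⟨rfl, h⟩ | ⟨rfl, h⟩)
      · exact ⟨y, h, rfl⟩
      · exact ⟨x, h, Sym2.eq_swap⟩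
  have h := prod_sign_pow_deg (P.chainSign w N) (N.toFinset.image fun z => s(w, z)) (-1)
    (fun e he => by
      obtain ⟨z, hz, rfl⟩ := Finset.mem_image.mp he
      simpa using hN (Set.mem_toFinset.mp hz))
    (fun x y hxy => by
      split_ifs with he
      · exact chainSign_mul_of_mem hP hN ((hmem x y).mp he)
      · exact chainSign_mul_of_notMem hxy fun h => he ((hmem x y).mpr h))
  rw [Finset.card_image_of_injective _ fun a b hab => by
      rcases Sym2.eq_iff.mp hab with h | h
      · exact h.2
      · exact h.2.trans h.1,
    ← Set.ncard_eq_toFinset_card'] at h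
  rw [h]
  push_cast
  rfl

variable (P w N)

open scoped Classical in
/-- `Q` arises from `P` by extruding a `0`-chain at `w`, with nodes named by `e`. -/
structure IsZeroChain (Q : DefectPlumbing.{u}) (e : P.V ⊕ Bool ≃ Q.V) : Prop where
  adj_inl_inl : ∀ x y, Q.graph.Adj (e (.inl x)) (e (.inl y)) ↔
    P.graph.Adj x y ∧ ¬ ((x = w ∧ y ∈ N) ∨ (y = w ∧ x ∈ N))
  adj_inl_false : ∀ x, Q.graph.Adj (e (.inl x)) (e (.inr false)) ↔ x = w
  adj_inl_true : ∀ x, Q.graph.Adj (e (.inl x)) (e (.inr true)) ↔ x ∈ N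
  adj_false_true : Q.graph.Adj (e (.inr false)) (e (.inr true))
  weight_inl : ∀ x, Q.weight (e (.inl x)) = P.weight x - if x = w then c else 0
  weight_false : Q.weight (e (.inr false)) = 0
  weight_true : Q.weight (e (.inr true)) = c
  nu_inl : ∀ x, Q.nu (e (.inl x)) = P.nu x
  nu_inr : ∀ i, Q.nu (e (.inr i)) = 0

theorem isZeroChain : P.IsZeroChain w N c (P.zeroChain w N c) (Equiv.refl _) where
  adj_inl_inl x y := by
    change ((Sum.inl x : P.V ⊕ Bool) ≠ Sum.inl y ∧
      ((P.graph.Adj x y ∧ ¬(x = w ∧ y ∈ N) ∧ ¬(y = w ∧ x ∈ N)) ∨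
      (P.graph.Adj y x ∧ ¬(y = w ∧ x ∈ N) ∧ ¬(x = w ∧ y ∈ N)))) ↔ _
    rw [P.graph.adj_comm y x]
    constructor
    · tauto
    · intro h
      exact ⟨fun e => h.1.ne (Sum.inl_injective e), by tauto⟩
  adj_inl_false x := by
    change ((Sum.inl x : P.V ⊕ Bool) ≠ Sum.inr false ∧ (x = w ∨ False)) ↔ _
    simp
  adj_inl_true x := by
    change ((Sum.inl x : P.V ⊕ Bool) ≠ Sum.inr true ∧ (x ∈ N ∨ False)) ↔ _
    simp
  adj_false_true := by
    change ((Sum.inr false : P.V ⊕ Bool) ≠ Sum.inr true ∧ (True ∨ False))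
    simp
  weight_inl x := by
    classical
    change (if x = w then P.weight x - c else P.weight x) = _
    split_ifs <;> simp
  weight_false := rfl
  weight_true := rfl
  nu_inl x := rfl
  nu_inr i := rfl

namespace IsZeroChain

variable {P w N c} {Q : DefectPlumbing.{u}} {e : P.V ⊕ Bool ≃ Q.V}

open scoped Classical in
theorem sum_ite_mem : ∑ y : P.V, (if y ∈ N then (1 : ℤ) else 0) = N.ncard := by
  rw [Set.ncard_eq_toFinset_card', Finset.sum_boole]
  congr 2
  ext x
  simp

open scoped Classical in
theorem deg_inl (H : P.IsZeroChain w N c Q e) (hN : N ⊆ P.graph.neighborSet w) (x : P.V) :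
    (Q.deg (e (.inl x)) : ℤ) = P.deg x + if x = w then 1 - (N.ncard : ℤ) else 0 := by
  have h1 := deg_eq_sum_add_sum e (e (.inl x))
  have hw : w ∉ N := fun h => P.graph.irrefl (hN h)
  have h2 : ∀ y, (if P.graph.Adj x y ∧ ¬ ((x = w ∧ y ∈ N) ∨ (y = w ∧ x ∈ N)) then (1 : ℤ) else 0) =
      (if P.graph.Adj x y then 1 else 0) - (if x = w then 1 else 0) * (if y ∈ N then 1 else 0) -
        (if y = w then (if x ∈ N then 1 else 0) else 0) := by
    intro y
    by_cases hxw : x = w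
    · subst hxw
      by_cases hy : y ∈ N
      · have : P.graph.Adj x y := hN hy
        simp [this, hy, hw]
      · simp [hy, hw]
    · by_cases hyw : y = w
      · subst hyw
        by_cases hx : x ∈ N
        · have : P.graph.Adj x y := (hN hx : P.graph.Adj y x).symm
          simp [this, hx, hxw]
        · simp [hx, hxw]
      · simp [hxw, hyw]
  simp only [H.adj_inl_inl, h2, Finset.sum_sub_distrib, Finset.sum_ite_eq', ← Finset.mul_sum,
    Finset.mem_univ, if_true, ← deg_eq_sum, Fintype.sum_bool, H.adj_inl_false, H.adj_inl_true,
    sum_ite_mem] at h1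
  rw [h1]
  split_ifs <;> ring

theorem deg_false (H : P.IsZeroChain w N c Q e) : Q.deg (e (.inr false)) = 2 := by
  classical
  have h1 := deg_eq_sum_add_sum e (e (.inr false))
  simp only [Q.graph.adj_comm (e (.inr false)) (e (.inl _)), H.adj_inl_false, Fintype.sum_bool,
    SimpleGraph.irrefl, if_false, Finset.sum_ite_eq', Finset.mem_univ, if_true,
    H.adj_false_true] at h1
  norm_num at h1
  exact_mod_cast h1

theorem deg_true (H : P.IsZeroChain w N c Q e) : Q.deg (e (.inr true)) = N.ncard + 1 := by
  classical
  have h1 := deg_eq_sum_add_sum e (e (.inr true))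
  simp only [Q.graph.adj_comm (e (.inr true)) (e (.inl _)), H.adj_inl_true, Fintype.sum_bool,
    SimpleGraph.irrefl, if_false, sum_ite_mem, Q.graph.adj_comm (e (.inr true)) (e (.inr false)),
    H.adj_false_true, if_true] at h1
  norm_num at h1
  exact_mod_cast h1

open scoped Classical in
/-- The matrix describing the change of coordinates. -/
def changeMatrix (P : DefectPlumbing.{u}) (w : P.V) (N : Set P.V) (c : ℤ) : Matrix Bool P.V ℤ :=
  -- Chosen as `B⁻¹` times the adjacency of the new nodes to the old ones, where `n₀` (index
  -- `false`) meets `w` and `n₁` (index `true`) meets `N`.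
  Matrix.of fun i x =>
    bif i then if x = w then 1 else 0 else (if x ∈ N then 1 else 0) - if x = w then c else 0

/-- The block of the plumbing matrix on the new nodes. -/
def blockMatrix (c : ℤ) : Matrix Bool Bool ℤ :=
  Matrix.of fun i j => bif i then bif j then c else 1 else bif j then 1 else 0

/-- The inverse of `blockMatrix`. -/
def blockMatrixInv (c : ℤ) : Matrix Bool Bool ℤ :=
  Matrix.of fun i j => bif i then bif j then 0 else 1 else bif j then 1 else -c

open scoped Classical in
theorem block_mul_change (i : Bool) (x : P.V) :
    (blockMatrix c * changeMatrix P w N c) i x =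
      bif i then if x ∈ N then 1 else 0 else if x = w then 1 else 0 := by
  rw [Matrix.mul_apply, Fintype.sum_bool]
  cases i <;> simp [blockMatrix, changeMatrix]

open scoped Classical in
theorem change_mul_block (x : P.V) (i : Bool) :
    ((changeMatrix P w N c).transpose * blockMatrix c) x i =
      bif i then if x ∈ N then 1 else 0 else if x = w then 1 else 0 := by
  rw [Matrix.mul_apply, Fintype.sum_bool]
  cases i <;> simp [blockMatrix, changeMatrix]

open scoped Classical in
theorem change_mul_block_mul_change (x y : P.V) :
    ((changeMatrix P w N c).transpose * blockMatrix c * changeMatrix P w N c) x y =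
      (if x ∈ N then 1 else 0) * (if y = w then 1 else 0) +
      (if x = w then 1 else 0) * (if y ∈ N then 1 else 0) -
      c * ((if x = w then 1 else 0) * (if y = w then 1 else 0)) := by
  rw [Matrix.mul_assoc, Matrix.mul_apply, Fintype.sum_bool, block_mul_change, block_mul_change]
  simp only [changeMatrix, Matrix.transpose_apply, Matrix.of_apply, cond_true, cond_false]
  split_ifs <;> ring

open scoped Classical in
/-- Extruding a `0`-chain is an extension by a hyperbolic block. -/
def extension (H : P.IsZeroChain w N c Q e) (hP : P.graph.IsTree)
    (hN : N ⊆ P.graph.neighborSet w) : Extension P Q Bool where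
  e := e
  s := P.chainSign w N
  K := changeMatrix P w N c
  B := blockMatrix c
  B' := blockMatrixInv c
  t₀ := fun i => bif i then (N.ncard : ℤ) + 1 else 0
  mul_inv := by
    ext i j
    rw [Matrix.mul_apply, Fintype.sum_bool]
    cases i <;> cases j <;> simp [blockMatrix, blockMatrixInv]
  inl_inl x y := by
    have hw : w ∉ N := fun h => P.graph.irrefl (hN h)
    rw [intMatrix_apply, intMatrix_apply, change_mul_block_mul_change, H.weight_inl]
    simp only [H.adj_inl_inl, EmbeddingLike.apply_eq_iff_eq, Sum.inl.injEq]
    by_cases hxy : x = y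
    · subst hxy
      rw [if_pos rfl, if_pos rfl, ← Units.val_mul, Int.units_mul_self]
      by_cases hx : x = w
      · subst hx
        simp [hw, sub_eq_add_neg]
      · simp [hx]
    · rw [if_neg hxy, if_neg hxy]
      have hww : ¬ (x = w ∧ y = w) := fun h => hxy (h.1.trans h.2.symm)
      have h0 : (if x = w then (1 : ℤ) else 0) * (if y = w then 1 else 0) = 0 := by
        by_cases hx : x = w
        · rw [if_neg fun hy => hww ⟨hx, hy⟩, mul_zero]
        · rw [if_neg hx, zero_mul]
      rw [h0, mul_zero, sub_zero]
      -- On an edge from `w` to `N` the term `KᵀBK` contributes `1`, cancelling the `-1` of the sign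
      -- change: the edge is detached from `w`.
      by_cases hm : (x = w ∧ y ∈ N) ∨ (y = w ∧ x ∈ N)
      · have hadj : P.graph.Adj x y := by
          rcases hm with ⟨rfl, h⟩ | ⟨rfl, h⟩
          · exact hN h
          · exact (hN h : P.graph.Adj _ _).symm
        rw [if_neg fun h => h.2 hm, if_pos hadj, ← Units.val_mul, chainSign_mul_of_mem hP hN hm]
        rcases hm with ⟨rfl, h⟩ | ⟨rfl, h⟩
        · simp [h, hw]
        · simp [h, hw]
      · have h1 : (if x ∈ N then (1 : ℤ) else 0) * (if y = w then 1 else 0) = 0 := by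
          by_cases hx : x ∈ N
          · rw [if_neg fun hy => hm (Or.inr ⟨hy, hx⟩), mul_zero]
          · rw [if_neg hx, zero_mul]
        have h2 : (if x = w then (1 : ℤ) else 0) * (if y ∈ N then 1 else 0) = 0 := by
          by_cases hx : x = w
          · rw [if_neg fun hy => hm (Or.inl ⟨hx, hy⟩), mul_zero]
          · rw [if_neg hx, zero_mul]
        rw [h1, h2, add_zero, add_zero]
        by_cases hadj : P.graph.Adj x y
        · rw [if_pos ⟨hadj, hm⟩, if_pos hadj, ← Units.val_mul, chainSign_mul_of_notMem hadj hm]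
          simp
        · rw [if_neg fun h => hadj h.1, if_neg hadj, mul_zero]
  inl_inr x i := by
    rw [intMatrix_apply, change_mul_block]
    simp only [EmbeddingLike.apply_eq_iff_eq, reduceCtorEq, if_false]
    cases i
    · simp only [H.adj_inl_false, cond_false]
    · simp only [H.adj_inl_true, cond_true]
  inr_inl i x := by
    rw [intMatrix_apply, block_mul_change]
    simp only [EmbeddingLike.apply_eq_iff_eq, reduceCtorEq, if_false,
      Q.graph.adj_comm (e (.inr i)) (e (.inl _))]
    cases i
    · simp only [H.adj_inl_false, cond_false]
    · simp only [H.adj_inl_true, cond_true]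
  inr_inr i j := by
    rw [intMatrix_apply]
    cases i <;> cases j <;>
      simp [blockMatrix, H.weight_false, H.weight_true, H.adj_false_true, H.adj_false_true.symm]
  nu_inl := H.nu_inl
  nu_inr := H.nu_inr
  even_inl x := by
    have hw : w ∉ N := fun h => P.graph.irrefl (hN h)
    rw [H.deg_inl hN, Fintype.sum_bool]
    by_cases hx : x = w
    · refine ⟨-N.ncard, ?_⟩
      simp [changeMatrix, hx]
      ring
    · simp [changeMatrix, hx]
  even_inr i := by
    cases i
    · rw [H.deg_false]; simp
    · rw [H.deg_true]; simp

theorem blockSignature (H : P.IsZeroChain w N c Q e) (hP : P.graph.IsTree)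
    (hN : N ⊆ P.graph.neighborSet w) : (H.extension hP hN).BlockSignature 1 1 := by
  -- Writing `x` for `t true` and `y` for `t false + c/2 * t true`, the form `2 t₀ t₁ + c t₁²` is
  -- `2xy = ((x + y)² - (x - y)²)/2`; the block is hyperbolic for every `c`.
  let C : (Bool → ℝ) →ₗ[ℝ] (Bool → ℝ) :=
    { toFun := fun t i => bif i then t true + (t false + c / 2 * t true)
        else t true - (t false + c / 2 * t true)
      map_add' := fun t t' => by ext i; cases i <;> simp <;> ring
      map_smul' := fun a t => by ext i; cases i <;> simp <;> ring }
  let C' : (Bool → ℝ) →ₗ[ℝ] (Bool → ℝ) :=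
    { toFun := fun t i => bif i then (t true + t false) / 2
        else (t true - t false) / 2 - c / 2 * ((t true + t false) / 2)
      map_add' := fun t t' => by ext i; cases i <;> simp <;> ring
      map_smul' := fun a t => by ext i; cases i <;> simp <;> ring }
  refine ⟨fun i => bif i then 1 / 2 else -1 / 2, C, C', fun t => ?_, fun t => ?_, ?_, ?_⟩
  · ext i
    cases i <;> simp [C, C'] <;> ring
  · change t ⬝ᵥ ((blockMatrix c).map ((↑) : ℤ → ℝ)).mulVec t = _
    simp [dotProduct, Matrix.mulVec, blockMatrix, C]
    ring
  · rw [Nat.card_eq_fintype_card, Fintype.card_subtype, Finset.card_eq_one]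
    exact ⟨true, by ext i; cases i <;> norm_num⟩
  · rw [Nat.card_eq_fintype_card, Fintype.card_subtype, Finset.card_eq_one]
    exact ⟨false, by ext i; cases i <;> norm_num⟩

theorem prefactor_mul (H : P.IsZeroChain w N c Q e) (hP : P.graph.IsTree)
    (hN : N ⊆ P.graph.neighborSet w) (τ : ℍ) : Q.prefactor τ * (-1) = P.prefactor τ := by
  classical
  have hw : ∑ q, (Q.weight q : ℝ) = ∑ x, (P.weight x : ℝ) := by
    rw [(H.extension hP hN).sum_weight]
    have h1 : ∀ x, Q.weight ((H.extension hP hN).e (.inl x)) = _ := H.weight_inl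
    have h2 : Q.weight ((H.extension hP hN).e (.inr false)) = _ := H.weight_false
    have h3 : Q.weight ((H.extension hP hN).e (.inr true)) = _ := H.weight_true
    simp only [h1, Fintype.sum_bool, h2, h3, Int.cast_sub, Int.cast_ite, Int.cast_zero,
      Finset.sum_sub_distrib, Finset.sum_ite_eq', Finset.mem_univ, if_true]
    ring
  rw [(H.extension hP hN).prefactor_eq (H.blockSignature hP hN), hw]
  simp [qPow_zero]

/-- Weak negativity excludes that both ends of the extruded chain have degree at least three. -/
theorem deg_le_two (H : P.IsZeroChain w N c Q e) (hN : N ⊆ P.graph.neighborSet w)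
    (hP : P.IsWeaklyNegativeTree) (hQ : Q.IsWeaklyNegativeTree) :
    N.ncard + 1 ≤ 2 ∨ Q.deg (e (.inl w)) ≤ 2 := by
  classical
  by_contra! hcon
  set X := H.extension hP.isTree hN with hX
  -- `up 0 t` is `e_w + e_{n₁}`. Its value under the inverse form is the `true`-`true` entry of
  -- `blockMatrixInv c`, which is `0`, contradicting negative definiteness if both nodes have degree
  -- at least 3.
  let t : Bool → ℝ := fun i => bif i then 1 else 0
  have hK : ∀ x, X.K true x = if x = w then 1 else 0 := fun _ => rfl
  have h1 : ∀ x, X.up 0 t (e (.inl x)) = if x = w then 1 else 0 := fun x => by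
    refine (X.up_inl 0 t x).trans ?_
    rw [Fintype.sum_bool, hK]
    simp [t]
  have h2 : ∀ i, X.up 0 t (e (.inr i)) = t i := fun i => X.up_inr 0 t i
  have h3 := hQ.neg_def (X.up 0 t) (X.forall_node.mpr ⟨fun x hx => ?_, fun i hi => ?_⟩)
    (fun h0 => by
      have := congrFun h0 (e (.inr true))
      rw [h2] at this
      simp [t] at this)
  · rw [X.invForm_up hP.det_ne_zero hQ.det_ne_zero] at h3
    have h4 : t ⬝ᵥ (X.B'.map ((↑) : ℤ → ℝ)).mulVec t = 0 := by
      change t ⬝ᵥ ((blockMatrixInv c).map ((↑) : ℤ → ℝ)).mulVec t = 0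
      simp [t, dotProduct, Matrix.mulVec, blockMatrixInv]
    rw [h4] at h3
    simp [invForm] at h3
  · refine (h1 x).trans (if_neg ?_)
    rintro rfl
    have : Q.deg (e (.inl x)) < 3 := hx
    omega
  · refine (h2 i).trans ?_
    cases i
    · rfl
    · have : Q.deg (e (.inr true)) < 3 := hi
      rw [H.deg_true] at this
      omega

theorem localIdentity (H : P.IsZeroChain w N c Q e) (hN : N ⊆ P.graph.neighborSet w)
    (hP : P.IsWeaklyNegativeTree) (hQ : Q.IsWeaklyNegativeTree) (τ : ℍ) :
    (H.extension hP.isTree hN).LocalIdentity τ (-1) := by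
  classical
  intro y hy
  set X := H.extension hP.isTree hN with hX
  have d1 : ∀ x, (Q.deg (X.e (.inl x)) : ℤ) = _ := H.deg_inl hN
  have d2 : Q.deg (X.e (.inr false)) = 2 := H.deg_false
  have d3 : Q.deg (X.e (.inr true)) = N.ncard + 1 := H.deg_true
  have hs : ∀ x, X.s x = P.chainSign w N x := fun _ => rfl
  have hsw : X.s w = 1 := chainSign_self hP.isTree hN
  have hK : ∀ x, X.K true x = if x = w then 1 else 0 := fun _ => rfl
  set a : ℤ := 1 - N.ncard with ha
  set n : ℤ := 2 - Q.deg (X.e (.inl w)) with hn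
  have hdw : (Q.deg (X.e (.inl w)) : ℤ) = P.deg w + a := by rw [d1, if_pos rfl]
  have han : a + n = 2 - P.deg w := by rw [hn, hdw]; ring
  -- This gives `n ≤ 1`, and `a ≤ 1` is clear, so a node of degree at most 2 means exponent `0` or
  -- `1`: the cases covered by the convolution lemma.
  have hle : N.ncard ≤ P.deg w := by
    unfold deg
    rw [← SimpleGraph.card_neighborSet_eq_degree, ← Nat.card_eq_fintype_card]
    exact Set.ncard_le_ncard hN
  have hcase : a = 0 ∨ a = 1 ∨ n = 0 ∨ n = 1 := by
    have : N.ncard + 1 ≤ 2 ∨ Q.deg (X.e (.inl w)) ≤ 2 := H.deg_le_two hN hP hQ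
    omega
  set C : ℂ := ∏ x ∈ Finset.univ.erase w, ((X.s x : ℤ) : ℂ) ^ P.deg x *
    pvCoeff (2 - (P.deg x : ℤ)) (P.nu x) (y x) with hC
  have hsign : (-1) ^ N.ncard * P.coeffProd y =
      pvCoeff (2 - (P.deg w : ℤ)) (P.nu w) (y w) * C := by
    rw [← prod_chainSign hP.isTree hN]
    unfold coeffProd
    rw [← Finset.prod_mul_distrib, ← Finset.mul_prod_erase Finset.univ _ (Finset.mem_univ w),
      chainSign_self hP.isTree hN]
    simp [hC, hs]
  set F : X.NewLabel → ℂ := fun t => qPow τ (-((fun i => (t.1 i : ℝ)) ⬝ᵥ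
      (X.B'.map ((↑) : ℤ → ℝ)).mulVec fun i => (t.1 i : ℝ)) / 4) * Q.coeffProd (X.up y t.1) with hF
  have hprod : ∀ t : Bool → ℤ, t false = 0 → Q.coeffProd (X.up y t) =
      pvCoeff a 0 (t true) * pvCoeff n (P.nu w) (y w + t true) * C := by
    intro t ht
    have herase : ∏ x ∈ Finset.univ.erase w, pvCoeff (2 - (Q.deg (X.e (.inl x)) : ℤ)) (P.nu x)
        ((X.s x : ℤ) * y x + ∑ i, X.K i x * t i) = C := by
      refine Finset.prod_congr rfl fun x hx => ?_
      have hx' : x ≠ w := Finset.ne_of_mem_erase hx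
      rw [d1, Fintype.sum_bool, hK, if_neg hx', if_neg hx', ht, add_zero, zero_mul, mul_zero,
        add_zero, add_zero, pvCoeff_sign_mul]
    rw [X.coeffProd_up, ← Finset.mul_prod_erase Finset.univ _ (Finset.mem_univ w), herase,
      Fintype.sum_bool, Fintype.prod_bool, hsw, hK, if_pos rfl, ht, d2, d3, mul_zero, add_zero,
      one_mul, Units.val_one, one_mul, show (2 - ((N.ncard + 1 : ℕ) : ℤ)) = a by push_cast; ring,
      show (2 - ((2 : ℕ) : ℤ)) = 0 by norm_num, pvCoeff_zero_zero, if_pos rfl]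
    ring
  -- The node `n₀` has degree 2, so its label must vanish. On such `t` the form of `blockMatrixInv
  -- c` is zero, no power of `q` survives and a plain convolution over the label `p` of `n₁`
  -- remains.
  have hzero : ∀ t : X.NewLabel, t.1 false ≠ 0 → F t = 0 := by
    intro t ht
    simp only [hF]
    rw [X.coeffProd_up, Fintype.prod_bool, d2, show (2 - ((2 : ℕ) : ℤ)) = 0 by norm_num,
      pvCoeff_zero_zero, if_neg ht, mul_zero, mul_zero, mul_zero]
  set k : ℤ := N.ncard + 1 with hk
  have ht0 : ∀ i, X.t₀ i = bif i then k else 0 := fun _ => rfl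
  let g : {p : ℤ // Even (p - k)} → X.NewLabel := fun p =>
    ⟨fun i => bif i then p.1 else 0, fun i => by
      rw [ht0]
      cases i
      · simp
      · exact p.2⟩
  have hg : Function.Injective g := fun p p' h =>
    Subtype.ext (congrFun (Subtype.ext_iff.mp h) true)
  have hsupp : Function.support F ⊆ Set.range g := by
    intro t ht
    have h0 : t.1 false = 0 := by
      by_contra h
      exact ht (hzero t h)
    refine ⟨⟨t.1 true, by simpa [ht0] using t.2 true⟩, Subtype.ext (funext fun i => ?_)⟩
    cases i
    · exact h0.symm
    · rfl
  have hFg : ∀ p, F (g p) = pvCoeff a 0 p * pvCoeff n (P.nu w) (y w + p) * C := by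
    intro p
    have hB : (fun i => ((g p).1 i : ℝ)) ⬝ᵥ
        (X.B'.map ((↑) : ℤ → ℝ)).mulVec (fun i => ((g p).1 i : ℝ)) = 0 := by
      change _ ⬝ᵥ ((blockMatrixInv c).map ((↑) : ℤ → ℝ)).mulVec _ = 0
      simp [g, dotProduct, Matrix.mulVec, blockMatrixInv]
    simp only [hF]
    rw [hB, neg_zero, zero_div, qPow_zero, one_mul, hprod _ rfl]
    rfl
  have hpar : Even (y w - a - n - P.nu w) := by
    have h := hy w
    have e : y w - a - n - P.nu w = (y w - P.deg w - P.nu w) + 2 * (P.deg w - 1) := by linarith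
    rw [e]
    exact h.add (even_two_mul _)
  change ∑' t, F t = _
  rw [← hg.tsum_eq hsupp]
  simp only [hFg]
  -- The convolution yields `(-1)^a` with `a = 1 - |N|` and the branch signs yield `(-1)^|N|`, so
  -- the total sign is `-1` whatever `N` is. The parity class is the right one as `k - a = 2|N|`.
  rw [tsum_mul_right, tsum_pvCoeff_mul hcase hpar ⟨N.ncard, by rw [hk, ha]; ring⟩, han, mul_assoc,
    ← hsign, ← mul_assoc, ha, zpow_sub₀ (by norm_num), zpow_natCast]
  have h1 : ((-1 : ℂ) ^ N.ncard) ≠ 0 := pow_ne_zero _ (by norm_num)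
  rw [div_mul_cancel₀ _ h1, zpow_one]

end IsZeroChain

open scoped Classical in
theorem zeroChain_exists_spinEquiv (hN : N ⊆ P.graph.neighborSet w) (hP : P.IsWeaklyNegativeTree)
    (hQ : (P.zeroChain w N c).IsWeaklyNegativeTree) :
    ∃ φ : P.SpinC ≃ (P.zeroChain w N c).SpinC,
      (∀ b : P.Label, ∃ b' : (P.zeroChain w N c).Label,
        b'.shifted = P.zeroChainTransport w N b.shifted ∧ φ b.toSpinC = b'.toSpinC) ∧
      ∀ (s : P.SpinC) (τ : ℍ), (P.zeroChain w N c).zhat (φ s) τ = P.zhat s τ := by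
  have H := P.isZeroChain w N c
  refine (H.extension hP.isTree hN).exists_spinEquiv hP hQ
    (fun τ => ⟨_, H.localIdentity hN hP hQ τ, H.prefactor_mul hP.isTree hN τ⟩) fun β => ?_
  refine funext ((H.extension hP.isTree hN).forall_node.mpr ⟨fun x => ?_, fun i => ?_⟩)
  · rw [Extension.up_inl, Fintype.sum_bool]
    change (if x = w then β x + ((N.ncard : ℤ) + 1)
      else if ∃ y ∈ N, x ∈ P.sideOf w y then -β x else β x) =
      (P.chainSign w N x : ℤ) * β x + ((if x = w then 1 else 0) * ((N.ncard : ℤ) + 1) + _ * 0)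
    by_cases hx : x = w
    · subst hx
      simp [chainSign_self hP.isTree hN]
    · rw [if_neg hx, if_neg hx]
      unfold chainSign
      split_ifs <;> simp
  · rw [Extension.up_inr]
    cases i <;> rfl

end Chain

end DefectPlumbing

namespace DefectPlumbing

/-! ### Isomorphisms of decorated plumbing graphs -/

section Iso

variable {P Q : DefectPlumbing.{u}} (e : P.graph ≃g Q.graph)

theorem deg_apply_iso (v : P.V) : Q.deg (e v) = P.deg v := by
  classical
  have h : (Q.deg (e v) : ℤ) = P.deg v := by
    rw [deg_eq_sum, deg_eq_sum, ← e.toEquiv.sum_comp]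
    exact Finset.sum_congr rfl fun w _ => if_congr e.map_adj_iff rfl rfl
  exact_mod_cast h

theorem intMatrix_apply_iso (hweight : ∀ v, Q.weight (e v) = P.weight v) (v w : P.V) :
    Q.intMatrix (e v) (e w) = P.intMatrix v w := by
  classical
  rw [intMatrix_apply, intMatrix_apply, hweight]
  exact if_congr e.injective.eq_iff rfl (if_congr e.map_adj_iff rfl rfl)

/-- An isomorphism of decorated plumbing graphs is an extension by an empty block. -/
def isoExtension (hweight : ∀ v, Q.weight (e v) = P.weight v) (hnu : ∀ v, Q.nu (e v) = P.nu v) :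
    Extension P Q Empty where
  e := (Equiv.sumEmpty P.V Empty).trans e.toEquiv
  s := 1
  K := 0
  B := 0
  B' := 0
  t₀ := 0
  mul_inv := Subsingleton.elim _ _
  inl_inl x y := (intMatrix_apply_iso e hweight x y).trans (by simp)
  inl_inr _ i := i.elim
  inr_inl i := i.elim
  inr_inr i := i.elim
  nu_inl := hnu
  nu_inr i := i.elim
  even_inl x := by
    have h : Q.deg (((Equiv.sumEmpty P.V Empty).trans e.toEquiv) (.inl x)) = P.deg x :=
      deg_apply_iso e x
    exact ⟨0, by rw [h]; simp⟩
  even_inr i := i.elim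

theorem iso_exists_spinEquiv (hweight : ∀ v, Q.weight (e v) = P.weight v)
    (hnu : ∀ v, Q.nu (e v) = P.nu v) (hP : P.IsWeaklyNegativeTree) (hQ : Q.IsWeaklyNegativeTree) :
    ∃ φ : P.SpinC ≃ Q.SpinC,
      (∀ b : P.Label, ∃ b' : Q.Label,
        b'.shifted = (fun x => b.shifted (e.symm x)) ∧ φ b.toSpinC = b'.toSpinC) ∧
      ∀ (s : P.SpinC) (τ : ℍ), Q.zhat (φ s) τ = P.zhat s τ := by
  set X := isoExtension e hweight hnu with hX
  have hd : ∀ x, Q.deg (X.e (.inl x)) = P.deg x := deg_apply_iso e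
  have hs : ∀ x, X.s x = 1 := fun _ => rfl
  refine X.exists_spinEquiv hP hQ (T := fun β x => β (e.symm x)) (fun τ => ⟨1, fun y _ => ?_, ?_⟩)
    fun β => ?_
  · let t : X.NewLabel := ⟨0, fun i => i.elim⟩
    rw [tsum_eq_single t fun t' ht => absurd (Subsingleton.elim t' t) ht, X.coeffProd_up]
    simp [hd, hs, coeffProd, qPow_zero]
  · have hB : X.BlockSignature 0 0 :=
      ⟨0, LinearMap.id, LinearMap.id, fun _ => rfl, fun _ => by simp, by simp, by simp⟩
    have hw : ∀ x, Q.weight (X.e (.inl x)) = P.weight x := hweight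
    rw [X.prefactor_eq hB, X.sum_weight]
    simp [hw, qPow_zero]
  · refine funext (X.forall_node.mpr ⟨fun x => ?_, fun i => i.elim⟩)
    rw [Extension.up_inl]
    have : e.symm (X.e (.inl x)) = x := e.symm_apply_apply x
    simp [this, hs]

end Iso

/-! ### Invariance under all moves -/

theorem KirbyMove.exists_spinEquiv {P Q : DefectPlumbing.{u}} {T : (P.V → ℤ) → (Q.V → ℤ)}
    (h : KirbyMove P Q T) (hP : P.IsWeaklyNegativeTree) (hQ : Q.IsWeaklyNegativeTree) :
    ∃ φ : P.SpinC ≃ Q.SpinC,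
      (∀ b : P.Label, ∃ b' : Q.Label, b'.shifted = T b.shifted ∧ φ b.toSpinC = b'.toSpinC) ∧
      ∀ (s : P.SpinC) (τ : ℍ), Q.zhat (φ s) τ = P.zhat s τ := by
  cases h with
  | edge u v h ε => exact edgeBlowUp_exists_spinEquiv P u v ε h hP hQ
  | leaf v ε => exact leafBlowUp_exists_spinEquiv P v ε hP hQ
  | chain w N hN c => exact zeroChain_exists_spinEquiv P w N c hN hP hQ
  | iso _ e hweight hnu => exact iso_exists_spinEquiv e hweight hnu hP hQ

theorem Label.shifted_injective {P : DefectPlumbing.{u}} :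
    Function.Injective (Label.shifted : P.Label → P.V → ℤ) := fun _ _ h =>
  Subtype.ext (funext fun v => add_right_cancel (congrFun h v))

end DefectPlumbing

theorem SpinPlumbing.Step.zhat_eq {X Y : SpinPlumbing.{u}} (h : X.Step Y) (τ : ℍ) :
    X.plumbing.zhat X.spin τ = Y.plumbing.zhat Y.spin τ := by
  obtain ⟨hX, hY, T, hT, b, b', hb, hb', hs⟩ := h
  obtain ⟨φ, hφ, hz⟩ := hT.exists_spinEquiv hX hY
  obtain ⟨c, hc, hbc⟩ := hφ b
  -- A step only records that the shifted labels correspond; as `ν` is fixed, they determine the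
  -- label, so the bijection `φ` must match the two `Spin^c` structures.
  obtain rfl : c = b' := DefectPlumbing.Label.shifted_injective (hc.trans hs.symm)
  rw [← hb, ← hb', ← hbc, hz]

theorem SpinPlumbing.zhat_eq_of_eqvGen {X Y : SpinPlumbing.{u}}
    (h : Relation.EqvGen SpinPlumbing.Step X Y) (τ : ℍ) :
    X.plumbing.zhat X.spin τ = Y.plumbing.zhat Y.spin τ := by
  induction h with
  | rel _ _ h => exact h.zhat_eq τ
  | refl _ => rfl
  | symm _ _ _ ih => exact ih.symm
  | trans _ _ _ _ _ ih₁ ih₂ => exact ih₁.trans ih₂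

end

theorem mainTheorem6 :
    -- the defining integrals and series exist
    (∀ P : DefectPlumbing.{u}, P.IsWeaklyNegativeTree → ∀ (b : P.Label) (τ : ℍ),
      (∀ ℓ ∈ P.thetaIndex b.shifted, ∃ I : ℂ,
        Filter.Tendsto (vpApprox fun z => P.kernel z * P.thetaTerm τ ℓ z) (𝓝[>] (0 : ℝ)) (𝓝 I)) ∧
      Summable fun ℓ : P.thetaIndex b.shifted => P.zhatTerm τ ℓ) ∧
    -- invariance under every move, with the induced bijection of `Spin^c` structures
    (∀ (P Q : DefectPlumbing.{u}) (T : (P.V → ℤ) → (Q.V → ℤ)),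
      DefectPlumbing.KirbyMove P Q T → P.IsWeaklyNegativeTree → Q.IsWeaklyNegativeTree →
      ∃ φ : P.SpinC ≃ Q.SpinC,
        (∀ b : P.Label, ∃ b' : Q.Label,
          b'.shifted = T b.shifted ∧ φ b.toSpinC = b'.toSpinC) ∧
        ∀ (s : P.SpinC) (τ : ℍ), Q.zhat (φ s) τ = P.zhat s τ) ∧
    -- invariance under finite sequences of moves and inverse moves
    (∀ X Y : SpinPlumbing.{u}, Relation.EqvGen SpinPlumbing.Step X Y →
      ∀ τ : ℍ, X.plumbing.zhat X.spin τ = Y.plumbing.zhat Y.spin τ) := by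
  refine ⟨fun P hP b τ => ⟨fun ℓ _ => ⟨_, P.tendsto_vpApprox τ ℓ⟩,
    (hP.summable_zhatTerm τ).subtype _⟩, fun P Q T h hP hQ => h.exists_spinEquiv hP hQ,
    fun X Y h τ => SpinPlumbing.zhat_eq_of_eqvGen h τ⟩
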